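/- Let $G$ be a second countable locally compact (Hausdorff) group, let $\mathcal H$ be a real affine Hilbert space with separable tangent space $\mathcal H^0$, and let $\alpha : G \curvearrowright \mathcal H$ be an affine isometric action (a homomorphism $G\to\mathrm{Isom}(\mathcal H)$ with continuous orbit maps). Let $\alpha^0 : G\curvearrowright \mathcal H^0$ be its linear part. For $t>0$ let $\mathcal H^t=\{tx : x\in\mathcal H\}$ be the affine Hilbert space with tangent space $\mathcal H^0$ in which $tx-ty=t(x-y)$, and let $\alpha^t: G\curvearrowright\mathcal H^t$ be given by $\alpha^t_g(tx)=t\,\alpha_g(x)$; for $t=0$ the action is $\alpha^0$ on $\mathcal H^0$. A Gaussian density over an affine Hilbert space $\mathcal K$ is a family of equivalent probability measures $(m_y)_{y\in\mathcal K}$ on a standard Borel space $X$ with a linear map $f\mapsto\widehat f$ from continuous affine functions on $\mathcal K$ to random variables on $X$ modulo null sets, such that $\widehat f$ has law $\mathcal N(f(y),\|f^0\|^2)$ under $m_y$ for all $y$ (where $f^0$ is the linear part of $f$), and the $\widehat f$ generate the $\sigma$-algebra modulo null sets. The Gaussian action $\widehat\beta$ of an affine isometric action $\beta:G\curvearrowright\mathcal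 K$ is the nonsingular action on $X$ with $(\widehat\beta_g)_*m_y=m_{\beta_g y}$ for all $g,y$; it exists and is unique up to isomorphism. Write $\widehat\alpha^t$ for the Gaussian action of $\alpha^t$. For a symmetric probability measure $\mu$ on $G$ and an orthogonal representation $\pi$ of $G$, put $\rho_\mu(\pi)=\left\|\int_G\pi(g)\,d\mu(g)\right\|$ (operator norm of the weak integral). Let $\rho_\mu(G)=\rho_\mu(\lambda_G)$ for the left regular representation $\lambda_G$ on $L^2(G)$, and for a nonsingular action $\sigma$ on $(X,\nu)$ let $\rho_\mu(\sigma)=\rho_\mu(\pi_\sigma)$ for the Koopman representation $(\pi_\sigma(g)h)(\omega)=\left(\frac{d g_*\nu}{d\nu}(\omega)\right)^{1/2}h(g^{-1}\omega)$ on $L^2(X,\nu)$. Let $\|\alpha\|_\mu^2=\inf_{x\in\mathcal H}\int_G\|gx-x\|^2\,d\mu(g)\in[0,\infty]$. **Theorem.** Let $\mu$ be a symmetric probability measure on $G$, let $x\in\mathcal H$, and let $b(g)=gx-x$. Let $(g_n)$ be the $\mu$-random walk on $G$ (so $g_n$ is a product of $n$ independent elements of law $\mu$). Then for every $s\ge 0$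 the limit $$f(s)=\lim_{n\to\infty}\mathbb E\left(e^{-s\|b(g_n)\|^2}\right)^{1/n}$$ exists and lies in $(0,1]$, and: (i) for all $t\ge0$, $\rho_\mu(\widehat\alpha^t)=f(t^2/8)$; (ii) for all $s\ge0$, $f(s)\ge\rho_\mu(G)$ and $f(s)\ge e^{-s\|\alpha\|_\mu^2}$ (the last bound being void if $\|\alpha\|_\mu^2=\infty$); (iii) $f$ is continuous and decreasing (non-increasing) on $[0,\infty)$, and $\log f$ is convex on $[0,\infty)$. -/

import Mathlib

open MeasureTheory ProbabilityTheory Filter Topology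
open scoped ENNReal NNReal RealInnerProductSpace

universe w

noncomputable section

/-! ### Inflations of an affine Hilbert space -/

/-- The inflation `𝓗ᵗ` of an affine Hilbert space `𝓗` by a factor `t > 0`. The point `⟨x⟩` is the
one written `t x`; the tangent space is unchanged and `t x - t y = t (x - y)`. -/
@[ext]
structure Inflation (t : {t : ℝ // 0 < t}) (P : Type*) where
  pt : P

namespace Inflation

variable {V P : Type*} [NormedAddCommGroup V] [InnerProductSpace ℝ V] [MetricSpace P]
  [NormedAddTorsor V P] (t : {t : ℝ // 0 < t})

instance : MetricSpace (Inflation t P) where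
  dist x y := t.1 * dist x.pt y.pt
  dist_self x := by simp
  dist_comm x y := by simp [dist_comm]
  dist_triangle x y z := by
    rw [← mul_add]
    exact mul_le_mul_of_nonneg_left (dist_triangle _ _ _) t.2.le
  eq_of_dist_eq_zero := by
    intro x y h
    have h' : dist x.pt y.pt = 0 := (mul_eq_zero.1 h).resolve_left t.2.ne'
    exact Inflation.ext (dist_eq_zero.1 h')

instance : NormedAddTorsor V (Inflation t P) where
  vadd v x := ⟨(t.1⁻¹ • v) +ᵥ x.pt⟩
  zero_vadd x := Inflation.ext (by
    change (t.1⁻¹ • (0 : V)) +ᵥ x.pt = x.pt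
    simp)
  add_vadd v w x := Inflation.ext (by
    change (t.1⁻¹ • (v + w)) +ᵥ x.pt = (t.1⁻¹ • v) +ᵥ ((t.1⁻¹ • w) +ᵥ x.pt)
    rw [smul_add, add_vadd])
  vsub x y := t.1 • (x.pt -ᵥ y.pt)
  nonempty := ⟨⟨(AddTorsor.nonempty (G := V) (P := P)).some⟩⟩
  vsub_vadd' x y := Inflation.ext (by
    change (t.1⁻¹ • t.1 • (x.pt -ᵥ y.pt)) +ᵥ y.pt = x.pt
    rw [inv_smul_smul₀ t.2.ne', vsub_vadd])
  vadd_vsub' v x := by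
    change t.1 • (((t.1⁻¹ • v) +ᵥ x.pt) -ᵥ x.pt) = v
    rw [vadd_vsub, smul_inv_smul₀ t.2.ne']
  dist_eq_norm' x y := by
    change t.1 * dist x.pt y.pt = ‖t.1 • (x.pt -ᵥ y.pt)‖
    rw [norm_smul, Real.norm_of_nonneg t.2.le, dist_eq_norm_vsub V]

theorem vadd_pt (v : V) (x : Inflation t P) : (v +ᵥ x).pt = (t.1⁻¹ • v) +ᵥ x.pt := rfl

theorem dist_eq (x y : Inflation t P) : dist x y = t.1 * dist x.pt y.pt := rfl

/-- The isometry `gᵗ` of `𝓗ᵗ` given by `gᵗ (t x) = t (g x)`. -/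
def isom (g : P ≃ᵃⁱ[ℝ] P) : Inflation t P ≃ᵃⁱ[ℝ] Inflation t P where
  toFun x := ⟨g x.pt⟩
  invFun x := ⟨g.symm x.pt⟩
  left_inv x := by simp
  right_inv x := by simp
  linear := g.linear
  map_vadd' x v := Inflation.ext (by
    change g (v +ᵥ x).pt = (t.1⁻¹ • g.linear v) +ᵥ g x.pt
    rw [vadd_pt]
    have h := g.toAffineEquiv.map_vadd x.pt (t.1⁻¹ • v)
    rw [map_smul] at h
    exact h)
  norm_map := g.norm_map

theorem isom_pt (g : P ≃ᵃⁱ[ℝ] P) (x : Inflation t P) : (isom t g x).pt = g x.pt := rfl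

end Inflation

/-! ### Affine isometric actions -/

/-- An affine isometric action of a topological group `G` on an affine Hilbert space `P`: a group
homomorphism to the isometry group, continuous for the topology of pointwise convergence. -/
structure AffineIsometricAction (G : Type*) {V : Type*} (P : Type*) [Group G] [TopologicalSpace G]
    [NormedAddCommGroup V] [InnerProductSpace ℝ V] [MetricSpace P] [NormedAddTorsor V P] where
  hom : G →* (P ≃ᵃⁱ[ℝ] P)
  continuous_orbit : ∀ x : P, Continuous fun g => hom g x

namespace AffineIsometricAction

variable {G V P : Type*} [Group G] [TopologicalSpace G] [NormedAddCommGroup V]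
  [InnerProductSpace ℝ V] [MetricSpace P] [NormedAddTorsor V P]

/-- The cocycle `b(g) = g x - x`. -/
def cocycle (α : AffineIsometricAction G P) (x : P) (g : G) : V := α.hom g x -ᵥ x

/-- The inflated action `αᵗ` on `𝓗ᵗ`, for `t > 0`. -/
def inflate (α : AffineIsometricAction G P) (t : {t : ℝ // 0 < t}) :
    AffineIsometricAction G (Inflation t P) where
  hom :=
    { toFun := fun g => Inflation.isom t (α.hom g)
      map_one' := by
        ext x
        simp [Inflation.isom_pt]
      map_mul' := fun g h => by
        ext x
        simp [Inflation.isom_pt] }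
  continuous_orbit x := by
    rw [continuous_iff_continuousAt]
    intro g
    have h : Tendsto (fun k => t.1 * dist (α.hom k x.pt) (α.hom g x.pt)) (𝓝 g) (𝓝 (t.1 * 0)) :=
      ((tendsto_iff_dist_tendsto_zero).1 ((α.continuous_orbit x.pt).tendsto g)).const_mul _
    rw [mul_zero] at h
    exact (tendsto_iff_dist_tendsto_zero).2 h

theorem linear_apply (g : P ≃ᵃⁱ[ℝ] P) (v : V) (x : P) :
    g.linearIsometryEquiv v = g (v +ᵥ x) -ᵥ g x := by
  rw [AffineIsometryEquiv.map_vadd, vadd_vsub]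

/-- The linear part `α⁰`, an affine isometric action on the tangent space. -/
def linearPart (α : AffineIsometricAction G P) : AffineIsometricAction G V where
  hom :=
    { toFun := fun g => (α.hom g).linearIsometryEquiv.toAffineIsometryEquiv
      map_one' := by
        ext v
        have x : P := (AddTorsor.nonempty (G := V) (P := P)).some
        change (α.hom 1).linearIsometryEquiv v = v
        rw [linear_apply _ v x, map_one, AffineIsometryEquiv.coe_one, id, id, vadd_vsub]
      map_mul' := fun g h => by
        ext v
        have x : P := (AddTorsor.nonempty (G := V) (P := P)).some
        change (α.hom (g * h)).linearIsometryEquiv v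
          = (α.hom g).linearIsometryEquiv ((α.hom h).linearIsometryEquiv v)
        rw [linear_apply _ v x, linear_apply (α.hom g) _ (α.hom h x), linear_apply _ v x,
          map_mul, vsub_vadd]
        rfl }
  continuous_orbit v := by
    have x : P := (AddTorsor.nonempty (G := V) (P := P)).some
    change Continuous fun g => (α.hom g).linearIsometryEquiv v
    simp only [linear_apply _ v x]
    exact (α.continuous_orbit _).vsub (α.continuous_orbit _)

/-- The square `‖α‖_μ²` of the `μ`-harmonic seminorm, with values in `[0, ∞]`. -/
def harmonicSq [MeasurableSpace G] (α : AffineIsometricAction G P) (μ : Measure G) : ℝ≥0∞ :=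
  ⨅ x : P, ∫⁻ g, ENNReal.ofReal (‖α.cocycle x g‖ ^ 2) ∂μ

end AffineIsometricAction

/-! ### Random walks -/

/-- Position after `n` steps of the random walk with increments `ω 0, ω 1, …`. -/
def walk {G : Type*} [Group G] (n : ℕ) (ω : ℕ → G) : G := ((List.range n).map ω).prod

/-- The expectation of `F (g_n)` where `(g_n)` is the `μ`-random walk, i.e. the increments are
independent with law `μ`. -/
def walkExpectation {G : Type*} [Group G] [MeasurableSpace G] (μ : Measure G) (n : ℕ)
    (F : G → ℝ) : ℝ :=
  ∫ ω, F (walk n ω) ∂(Measure.infinitePi fun _ : ℕ => μ)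

/-! ### The `μ`-spectral radius of a representation -/

/-- `HasSpectralRadius U μ r` says that the averaged operator `P = ∫ U g dμ(g)` exists
(as a weak integral) and that its operator norm is `r`. The operator `P` is unique. -/
def HasSpectralRadius {G H : Type*} [MeasurableSpace G] [NormedAddCommGroup H]
    [InnerProductSpace ℝ H] (U : G → H →L[ℝ] H) (μ : Measure G) (r : ℝ) : Prop :=
  ∃ P : H →L[ℝ] H,
    (∀ ξ η : H, Integrable (fun g => ⟪U g ξ, η⟫) μ ∧ ⟪P ξ, η⟫ = ∫ g, ⟪U g ξ, η⟫ ∂μ) ∧ ‖P‖ = r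

/-- The left regular representation `(λ_g ξ)(h) = ξ (g⁻¹ h)` on `L²(G)` (left Haar measure). -/
def leftRegular (G : Type*) [Group G] [TopologicalSpace G] [IsTopologicalGroup G]
    [LocallyCompactSpace G] [SecondCountableTopology G] [MeasurableSpace G] [BorelSpace G]
    (g : G) :
    Lp ℝ 2 (Measure.haar : Measure G) →L[ℝ] Lp ℝ 2 (Measure.haar : Measure G) :=
  (Lp.compMeasurePreservingₗᵢ ℝ (fun h => g⁻¹ * h)
    (measurePreserving_mul_left Measure.haar g⁻¹)).toContinuousLinearMap

/-! ### Nonsingular actions and their Koopman representations -/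

/-- A nonsingular action of `G` on the measure class of `ν`: a homomorphism, up to null sets, to
the nonsingular automorphisms, continuous for the topology of `Aut(X)` in which `θ → id` means that
`‖θ_* η - η‖ → 0` for all probability measures `η ≪ ν`. -/
structure NonsingularAction (G X : Type*) [Group G] [TopologicalSpace G] [MeasurableSpace X]
    (ν : Measure X) where
  act : G → X → X
  quasi : ∀ g, Measure.QuasiMeasurePreserving (act g) ν ν
  one_ae : ∀ᵐ ω ∂ν, act 1 ω = ω
  mul_ae : ∀ g h, ∀ᵐ ω ∂ν, act (g * h) ω = act g (act h ω)
  continuous_at_one : ∀ η : Measure X, IsProbabilityMeasure η → η ≪ ν → ∀ ε : ℝ, 0 < ε →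
    ∀ᶠ g in 𝓝 (1 : G), ∀ S, MeasurableSet S → |(η.map (act g)).real S - η.real S| ≤ ε

namespace NonsingularAction

variable {G X : Type*} [Group G] [TopologicalSpace G] [MeasurableSpace X] {ν : Measure X}

/-- `(d(g_* ν)/dν)^{1/2} (ω) · h (g⁻¹ ω)`. -/
def koopmanFun (A : NonsingularAction G X ν) (g : G) (h : X → ℝ) (ω : X) : ℝ :=
  Real.sqrt (((ν.map (A.act g)).rnDeriv ν ω).toReal) * h (A.act g⁻¹ ω)

theorem koopmanFun_congr (A : NonsingularAction G X ν) (g : G) {h k : X → ℝ} (hk : h =ᵐ[ν] k) :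
    A.koopmanFun g h =ᵐ[ν] A.koopmanFun g k := by
  filter_upwards [(A.quasi g⁻¹).ae_eq_comp hk] with ω hω
  simp only [Function.comp] at hω
  simp [koopmanFun, hω]

theorem aestronglyMeasurable_koopmanFun (A : NonsingularAction G X ν) (g : G) {h : X → ℝ}
    (hh : AEStronglyMeasurable h ν) : AEStronglyMeasurable (A.koopmanFun g h) ν :=
  ((Measure.measurable_rnDeriv _ _).ennreal_toReal.sqrt.aestronglyMeasurable).mul
    (hh.comp_quasiMeasurePreserving (A.quasi g⁻¹))

variable [IsProbabilityMeasure ν]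

theorem eLpNorm_koopmanFun (A : NonsingularAction G X ν) (g : G) {h : X → ℝ}
    (hh : AEStronglyMeasurable h ν) : eLpNorm (A.koopmanFun g h) 2 ν = eLpNorm h 2 ν := by
  have : IsProbabilityMeasure (ν.map (A.act g)) :=
    Measure.isProbabilityMeasure_map (A.quasi g).measurable.aemeasurable
  have hm : AEMeasurable (fun ω => ‖h (A.act g⁻¹ ω)‖ₑ ^ (2 : ℝ)) ν :=
    ((hh.comp_quasiMeasurePreserving (A.quasi g⁻¹)).enorm).pow_const _
  have key : ∫⁻ ω, ‖A.koopmanFun g h ω‖ₑ ^ (2 : ℝ) ∂ν = ∫⁻ ω, ‖h ω‖ₑ ^ (2 : ℝ) ∂ν := by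
    calc ∫⁻ ω, ‖A.koopmanFun g h ω‖ₑ ^ (2 : ℝ) ∂ν
        = ∫⁻ ω, (ν.map (A.act g)).rnDeriv ν ω * ‖h (A.act g⁻¹ ω)‖ₑ ^ (2 : ℝ) ∂ν := by
          refine lintegral_congr_ae ?_
          filter_upwards [Measure.rnDeriv_lt_top (ν.map (A.act g)) ν] with ω hω
          simp only [koopmanFun, enorm_mul]
          rw [ENNReal.mul_rpow_of_nonneg _ _ (by norm_num)]
          congr 1
          rw [Real.enorm_of_nonneg (Real.sqrt_nonneg _),
            ENNReal.ofReal_rpow_of_nonneg (Real.sqrt_nonneg _) (by norm_num)]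
          rw [Real.rpow_two, Real.sq_sqrt ENNReal.toReal_nonneg, ENNReal.ofReal_toReal hω.ne]
      _ = ∫⁻ ω, ‖h (A.act g⁻¹ ω)‖ₑ ^ (2 : ℝ) ∂(ν.map (A.act g)) :=
          lintegral_rnDeriv_mul (A.quasi g).absolutelyContinuous hm
      _ = ∫⁻ ω, ‖h (A.act g⁻¹ (A.act g ω))‖ₑ ^ (2 : ℝ) ∂ν :=
          lintegral_map' (hm.mono_ac (A.quasi g).absolutelyContinuous)
            (A.quasi g).measurable.aemeasurable
      _ = ∫⁻ ω, ‖h ω‖ₑ ^ (2 : ℝ) ∂ν := by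
          refine lintegral_congr_ae ?_
          filter_upwards [A.mul_ae g⁻¹ g, A.one_ae] with ω h1 h2
          rw [← h1, inv_mul_cancel, h2]
  rw [eLpNorm_eq_lintegral_rpow_enorm_toReal (by norm_num) (by norm_num),
    eLpNorm_eq_lintegral_rpow_enorm_toReal (by norm_num) (by norm_num)]
  simp only [ENNReal.toReal_ofNat]
  rw [key]

theorem memLp_koopmanFun (A : NonsingularAction G X ν) (g : G) {h : X → ℝ} (hh : MemLp h 2 ν) :
    MemLp (A.koopmanFun g h) 2 ν :=
  ⟨A.aestronglyMeasurable_koopmanFun g hh.1, by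
    rw [A.eLpNorm_koopmanFun g hh.1]
    exact hh.2⟩

/-- The Koopman representation `(π(g) h)(ω) = (d(g_* ν)/dν)^{1/2}(ω) h(g⁻¹ ω)` on `L²(X, ν)`.
This is the canonical representation on half-densities, trivialized by `h ↦ h ν^{1/2}`. -/
def koopman (A : NonsingularAction G X ν) (g : G) : Lp ℝ 2 ν →L[ℝ] Lp ℝ 2 ν :=
  LinearMap.mkContinuous
    { toFun := fun h => (A.memLp_koopmanFun g (Lp.memLp h)).toLp _
      map_add' := fun h k => by
        rw [← MemLp.toLp_add]
        refine MemLp.toLp_congr _ _ ((A.koopmanFun_congr g (Lp.coeFn_add h k)).trans ?_)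
        refine Eventually.of_forall fun ω => ?_
        simp [koopmanFun, mul_add]
      map_smul' := fun c h => by
        rw [RingHom.id_apply, ← MemLp.toLp_const_smul]
        refine MemLp.toLp_congr _ _ ((A.koopmanFun_congr g (Lp.coeFn_smul c h)).trans ?_)
        refine Eventually.of_forall fun ω => ?_
        simp only [koopmanFun, Pi.smul_apply, smul_eq_mul]
        ring }
    1 fun h => by
      simp only [LinearMap.coe_mk, AddHom.coe_mk, one_mul]
      rw [Lp.norm_toLp, A.eLpNorm_koopmanFun g (Lp.memLp h).1, Lp.norm_def]

end NonsingularAction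

/-! ### Gaussian densities and Gaussian actions -/

/-- A Gaussian density over the affine Hilbert space `P`: a family of equivalent probability
measures `m x`, `x ∈ P`, together with a linear map `f ↦ f̂` from the continuous affine functions
on `P` to random variables (modulo null sets), such that `f̂` has law `𝓝(f x, ‖f⁰‖²)` under `m x`
and the variables `f̂` generate the σ-algebra (modulo null sets). -/
structure IsGaussianDensity {V P X : Type*} [NormedAddCommGroup V] [InnerProductSpace ℝ V]
    [MetricSpace P] [NormedAddTorsor V P] [MeasurableSpace X] (m : P → Measure X) : Prop where
  prob : ∀ x, IsProbabilityMeasure (m x)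
  equiv : ∀ x y, m x ≪ m y
  exists_hat : ∃ hat : (P →ᴬ[ℝ] ℝ) → X → ℝ,
    (∀ f, Measurable (hat f)) ∧
    (∀ f k x, hat (f + k) =ᵐ[m x] hat f + hat k) ∧
    (∀ (c : ℝ) f x, hat (c • f) =ᵐ[m x] c • hat f) ∧
    (∀ f x, (m x).map (hat f) = gaussianReal (f x) (‖f.contLinear‖₊ ^ 2)) ∧
    (∀ S, MeasurableSet S → ∃ S', MeasurableSet[⨆ f, MeasurableSpace.comap (hat f) inferInstance] S'
      ∧ ∀ x, S =ᵐ[m x] S')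

/-- `A` is the nonsingular Gaussian action associated to `β`, on the Gaussian density `m`:
`(A g)_* m_x = m_{g x}` for all `g` and `x`. -/
def IsGaussianAction {G V P X : Type*} [Group G] [TopologicalSpace G] [NormedAddCommGroup V]
    [InnerProductSpace ℝ V] [MetricSpace P] [NormedAddTorsor V P] [MeasurableSpace X]
    (β : AffineIsometricAction G P) (m : P → Measure X) {ν : Measure X}
    (A : NonsingularAction G X ν) : Prop :=
  ∀ g x, (m x).map (A.act g) = m (β.hom g x)

/-- The `μ`-spectral radius of the Gaussian action of `β` is `r`. The Gaussian action is unique up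
to isomorphism but is realized on a Gaussian density that has to be chosen. So this says that some
realization exists, on a standard Borel space, and that in every realization, and for every
trivialization of the canonical `L²`-space by a measure `m y`, the Koopman representation has
`μ`-spectral radius `r`. -/
def HasGaussianSpectralRadius {G V P : Type*} [Group G]
    [TopologicalSpace G] [MeasurableSpace G]
    [NormedAddCommGroup V] [InnerProductSpace ℝ V] [MetricSpace P] [NormedAddTorsor V P]
    (β : AffineIsometricAction G P) (μ : Measure G) (r : ℝ) : Prop :=
  (∃ (X : Type) (_ : MeasurableSpace X) (_ : StandardBorelSpace X) (m : P → Measure X),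
    IsGaussianDensity m ∧ ∀ y, ∃ A : NonsingularAction G X (m y), IsGaussianAction β m A) ∧
  ∀ (X : Type w) [MeasurableSpace X] [StandardBorelSpace X] (m : P → Measure X)
    [∀ x, IsProbabilityMeasure (m x)], IsGaussianDensity m →
    ∀ (y : P) (A : NonsingularAction G X (m y)), IsGaussianAction β m A →
      HasSpectralRadius A.koopman μ r

end

/-! Trivialize the Koopman representation by `m y`. The half-densities `ξ a = (d m_a / d m_y)^{1/2}`
are unit vectors with dense span, the group permutes them by `π(g) (ξ a) = ξ (g a)`, and the
Cameron-Martin formula gives `⟪ξ a, ξ b⟫ = exp (-d(a, b)² / 8)`. Everything about the representation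
follows from these three facts (`IsGaussianKernel`).

Let `T` be the averaged operator; it is self-adjoint because `μ` is symmetric. Then `E exp
(-‖b(g_n)‖² / 8) = ⟪Tⁿ (ξ x), ξ x⟫ ≤ ‖T‖ⁿ`. Conversely, for `r < ‖T‖` there is `η` in the span of
the `ξ a` with `r ‖η‖ ≤ ‖T η‖`. Log-convexity of `n ↦ ‖Tⁿ η‖` propagates this to `r²ⁿ ‖η‖² ≤ ⟪T²ⁿ η,
η⟫`. The coefficient `⟪π(g) η, η⟫` is at most `C exp (-c ‖b(g)‖² / 8)` for any fixed `c < 1`, the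
loss `c` paying for the change of base point. Hölder's inequality bounds `E exp (-c s ‖b‖²)` by `(E
exp (-s ‖b‖²))^c`, so letting `c → 1` after `n → ∞` identifies the growth rate with `‖T‖`
(`tendsto_walkLaplace_rpow`, `IsGaussianKernel.exists_hasSpectralRadius`). Inflation by `t`
multiplies the cocycle norm by `t`, so every `s = t² / 8 > 0` is covered. The existence of the limit
thus rests on the existence of Gaussian actions, constructed on a product of standard Gaussian
lines.

For the regular representation the same lower bound applies to compactly supported vectors: their
coefficients live on a compact set, where `exp (-s ‖b‖²)` is bounded below. The bound by the
harmonic seminorm is Jensen's inequality for a single step, optimized over base points, on which `f`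
does not depend. Monotonicity and log-convexity pass to the limit. Continuity follows from convexity
in the interior and from the single-step bound at `0`. -/

/-! ### Uniqueness of measures -/

/-- A moment generating function finite on the whole line extends analytically to the plane, and its
values on the imaginary axis are the characteristic function. -/
theorem map_eq_of_mgf_eq {Ω Ω' : Type*} [MeasurableSpace Ω] [MeasurableSpace Ω'] {μ : Measure Ω}
    {μ' : Measure Ω'} [IsFiniteMeasure μ] [IsFiniteMeasure μ'] {X : Ω → ℝ} {Y : Ω' → ℝ}
    (hX : AEMeasurable X μ) (hY : AEMeasurable Y μ')
    (hint : ∀ t : ℝ, Integrable (fun ω => Real.exp (t * X ω)) μ) (h : mgf X μ = mgf Y μ') :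
    μ.map X = μ'.map Y := by
  have h0 : μ = 0 ↔ μ' = 0 := by
    have h1 := congrFun h 0
    simp only [mgf_zero'] at h1
    rw [← Measure.measure_univ_eq_zero, ← Measure.measure_univ_eq_zero (μ := μ')]
    rw [← measureReal_eq_zero_iff, ← measureReal_eq_zero_iff, h1]
  refine Measure.ext_of_complexMGF_eq hX hY (funext fun z => ?_)
  refine eqOn_complexMGF_of_mgf' h h0 ?_
  have : integrableExpSet X μ = Set.univ := Set.eq_univ_of_forall hint
  simp [this]

/-- Cramér-Wold on each finite set of coordinates, followed by uniqueness of projective limits of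
finite measures. The index set may be uncountable, as is needed for `I = V`. -/
theorem map_pi_eq_of_map_sum_eq {I Ω : Type*} [MeasurableSpace Ω] {Y : I → Ω → ℝ}
    (hY : ∀ i, Measurable (Y i)) {μ ν : Measure Ω} [IsFiniteMeasure μ] [IsFiniteMeasure ν]
    (h : ∀ (s : Finset I) (c : I → ℝ), μ.map (fun ω => ∑ i ∈ s, c i * Y i ω)
      = ν.map (fun ω => ∑ i ∈ s, c i * Y i ω)) :
    μ.map (fun ω i => Y i ω) = ν.map (fun ω i => Y i ω) := by
  classical
  have hm : Measurable (fun ω i => Y i ω) := measurable_pi_lambda _ hY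
  refine IsProjectiveLimit.unique (P := fun s : Finset I => (ν.map (fun ω i => Y i ω)).map
    s.restrict) (fun s => ?_) (fun s => rfl)
  beta_reduce
  rw [Measure.map_map (by fun_prop) hm, Measure.map_map (by fun_prop) hm]
  refine Measure.ext_of_charFunDual (funext fun L => ?_)
  rw [charFunDual_eq_charFun_map_one, charFunDual_eq_charFun_map_one]
  congr 1
  have hr : Measurable (s.restrict ∘ fun ω i => Y i ω) := by fun_prop
  rw [Measure.map_map (by fun_prop) hr, Measure.map_map (by fun_prop) hr]
  -- The coefficients are the values of `L` on the basis vectors, extended by zero outside `s`.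
  have := h s (fun i => if hi : i ∈ s then L (Pi.single ⟨i, hi⟩ 1) else 0)
  convert this using 2 <;>
  · funext ω
    rw [← Finset.sum_coe_sort s]
    simp only [Function.comp]
    rw [← ContinuousLinearMap.coe_coe, LinearMap.pi_apply_eq_sum_univ L.toLinearMap]
    refine Finset.sum_congr rfl fun i _ => ?_
    simp [mul_comm, Finset.restrict]
    left
    congr 1
    funext j
    simp [Pi.single_apply, eq_comm]

/-! ### Isonormal Gaussian processes -/

/-- `W` is an isonormal Gaussian process over the Hilbert space `V` on the probability space
`(X, p)`, generating the σ-algebra modulo null sets. -/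
structure IsIsonormal {V X : Type*} [NormedAddCommGroup V] [InnerProductSpace ℝ V]
    [MeasurableSpace X] (W : V → X → ℝ) (p : Measure X) : Prop where
  measurable : ∀ v, Measurable (W v)
  add_ae : ∀ u v, W (u + v) =ᵐ[p] W u + W v
  smul_ae : ∀ (c : ℝ) v, W (c • v) =ᵐ[p] c • W v
  law : ∀ v, p.map (W v) = gaussianReal 0 (‖v‖₊ ^ 2)
  generates : ∀ S, MeasurableSet S →
    ∃ S', MeasurableSet[⨆ v, MeasurableSpace.comap (W v) inferInstance] S' ∧ S =ᵐ[p] S'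

/-! ### Cameron-Martin shifts and half-densities. -/

section CameronMartin

variable {V X : Type*} [NormedAddCommGroup V]

/-- The density of the Cameron-Martin shift by `v`. -/
noncomputable def cameronMartin (W : V → X → ℝ) (v : V) (x : X) : ℝ := Real.exp (W v x - ‖v‖ ^ 2 / 2)

/-- The Cameron-Martin shift of `p` by `v`. -/
noncomputable def shiftMeasure (W : V → X → ℝ) [MeasurableSpace X] (p : Measure X) (v : V) :
    Measure X :=
  p.withDensity fun x => ENNReal.ofReal (cameronMartin W v x)

/-- The square root of the density of the Cameron-Martin shift by `v`. -/
noncomputable def halfDensity (W : V → X → ℝ) (v : V) (x : X) : ℝ := Real.exp (W v x / 2 - ‖v‖ ^ 2 / 4)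

theorem halfDensity_eq_sqrt (W : V → X → ℝ) (v : V) (x : X) :
    halfDensity W v x = Real.sqrt (cameronMartin W v x) := by
  rw [halfDensity, cameronMartin, Real.sqrt_eq_rpow, ← Real.exp_mul]
  ring_nf

theorem shiftMeasure_absolutelyContinuous [MeasurableSpace X] (W : V → X → ℝ) (p : Measure X)
    (v : V) : shiftMeasure W p v ≪ p :=
  withDensity_absolutelyContinuous _ _

end CameronMartin

namespace IsIsonormal

variable {V X : Type*} [NormedAddCommGroup V] [InnerProductSpace ℝ V] [MeasurableSpace X]
  {W : V → X → ℝ} {p : Measure X}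

theorem isProbabilityMeasure (h : IsIsonormal W p) : IsProbabilityMeasure p := by
  have : IsProbabilityMeasure (p.map (W 0)) := by rw [h.law]; infer_instance
  exact Measure.isProbabilityMeasure_of_map (W 0)

theorem zero_ae (h : IsIsonormal W p) : W 0 =ᵐ[p] 0 := by
  have := h.smul_ae 0 0
  simpa using this

theorem sum_ae (h : IsIsonormal W p) {I : Type*} (s : Finset I) (c : I → ℝ) (v : I → V) :
    (fun x => ∑ i ∈ s, c i * W (v i) x) =ᵐ[p] W (∑ i ∈ s, c i • v i) := by
  classical
  induction s using Finset.induction_on with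
  | empty =>
    simp only [Finset.sum_empty]
    exact h.zero_ae.symm
  | insert i s hi ih =>
    rw [Finset.sum_insert hi]
    filter_upwards [ih, h.add_ae (c i • v i) (∑ i ∈ s, c i • v i), h.smul_ae (c i) (v i)]
      with x h1 h2 h3
    rw [Finset.sum_insert hi, h1, h2, Pi.add_apply, h3]
    rfl

/-- Almost sure linearity turns a finite combination of the `W v` into a single `W v`, so
one-dimensional laws determine the joint law, and `generates` passes to all measurable sets.
Absolute continuity transports the `p`-a.e. identities to `q₁` and `q₂`. -/
theorem ext (h : IsIsonormal W p) {q₁ q₂ : Measure X} [IsFiniteMeasure q₁] [IsFiniteMeasure q₂]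
    (h₁ : q₁ ≪ p) (h₂ : q₂ ≪ p) (hq : ∀ v, q₁.map (W v) = q₂.map (W v)) : q₁ = q₂ := by
  have key := map_pi_eq_of_map_sum_eq (μ := q₁) (ν := q₂) h.measurable fun s c => by
    have e := h.sum_ae s c id
    simp only [id] at e
    rw [Measure.map_congr (h₁.ae_le e), hq,
      Measure.map_congr (h₂.ae_le e)]
  have hm : Measurable (fun x v => W v x) := measurable_pi_lambda _ h.measurable
  ext S hS
  obtain ⟨S', hS', hSS⟩ := h.generates S hS
  rw [measure_congr (h₁.ae_le hSS), measure_congr (h₂.ae_le hSS)]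
  have e : (⨆ v, MeasurableSpace.comap (W v) inferInstance)
      = MeasurableSpace.comap (fun x v => W v x) inferInstance := by
    simp [MeasurableSpace.pi, MeasurableSpace.comap_iSup, MeasurableSpace.comap_comp,
      Function.comp_def]
  rw [e] at hS'
  obtain ⟨T, hT, rfl⟩ := hS'
  rw [← Measure.map_apply hm hT, key, Measure.map_apply hm hT]

theorem integrable_exp_mul (h : IsIsonormal W p) (v : V) (t : ℝ) :
    Integrable (fun x => Real.exp (t * W v x)) p := by
  have := integrable_exp_mul_gaussianReal (μ := 0) (v := ‖v‖₊ ^ 2) t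
  rw [← h.law v] at this
  exact (integrable_map_measure (by fun_prop) (h.measurable v).aemeasurable).1 this

theorem integrable_exp (h : IsIsonormal W p) (v : V) (c : ℝ) :
    Integrable (fun x => Real.exp (W v x + c)) p := by
  simpa [Real.exp_add] using (h.integrable_exp_mul v 1).mul_const (Real.exp c)

theorem integral_exp (h : IsIsonormal W p) (v : V) (c : ℝ) :
    ∫ x, Real.exp (W v x + c) ∂p = Real.exp (‖v‖ ^ 2 / 2 + c) := by
  have := mgf_gaussianReal (h.law v) 1
  simp only [mgf, one_mul] at this
  simp [Real.exp_add, integral_mul_const, this]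

theorem measurable_cameronMartin (h : IsIsonormal W p) (v : V) :
    Measurable (cameronMartin W v) :=
  ((h.measurable v).sub_const _).exp

theorem integral_shiftMeasure (h : IsIsonormal W p) (v : V) (F : X → ℝ) :
    ∫ x, F x ∂(shiftMeasure W p v) = ∫ x, cameronMartin W v x * F x ∂p := by
  rw [shiftMeasure, integral_withDensity_eq_integral_toReal_smul
    (h.measurable_cameronMartin v).ennreal_ofReal (by simp)]
  simp [cameronMartin, ENNReal.toReal_ofReal (Real.exp_pos _).le]

theorem absolutelyContinuous_shiftMeasure (h : IsIsonormal W p) (v : V) :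
    p ≪ shiftMeasure W p v := by
  refine withDensity_absolutelyContinuous' (h.measurable_cameronMartin v).ennreal_ofReal.aemeasurable
    (Eventually.of_forall fun x => ?_)
  simp [cameronMartin, Real.exp_pos]

theorem isProbabilityMeasure_shiftMeasure (h : IsIsonormal W p) (v : V) :
    IsProbabilityMeasure (shiftMeasure W p v) := by
  constructor
  have h1 := h.integrable_exp v (-(‖v‖ ^ 2 / 2))
  rw [shiftMeasure, withDensity_apply _ MeasurableSet.univ, Measure.restrict_univ]
  simp only [cameronMartin, sub_eq_add_neg]
  rw [← ofReal_integral_eq_lintegral_ofReal h1 (Eventually.of_forall fun _ => (Real.exp_pos _).le),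
    h.integral_exp]
  simp

/-- The density times `exp (t W u)` is, up to a constant, the exponential of `W (v + t u)`. The
moment generating function of `W u` is therefore that of a Gaussian with mean `⟪u, v⟫`. -/
theorem map_shiftMeasure (h : IsIsonormal W p) (u v : V) :
    (shiftMeasure W p v).map (W u) = gaussianReal ⟪u, v⟫ (‖u‖₊ ^ 2) := by
  have := h.isProbabilityMeasure_shiftMeasure v
  have := h.isProbabilityMeasure
  have e : ∀ t : ℝ, (fun x => cameronMartin W v x * Real.exp (t * W u x)) =ᵐ[p]
      fun x => Real.exp (W (v + t • u) x + -(‖v‖ ^ 2 / 2)) := fun t => by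
    filter_upwards [h.add_ae v (t • u), h.smul_ae t u] with x h1 h2
    rw [h1, cameronMartin, ← Real.exp_add, Pi.add_apply, h2, Pi.smul_apply, smul_eq_mul]
    ring_nf
  have hi : ∀ t : ℝ, Integrable (fun x => Real.exp (t * W u x)) (shiftMeasure W p v) := fun t => by
    rw [shiftMeasure, integrable_withDensity_iff_integrable_smul'
      (h.measurable_cameronMartin v).ennreal_ofReal (by simp)]
    refine ((h.integrable_exp (v + t • u) (-(‖v‖ ^ 2 / 2))).congr (e t).symm).congr ?_
    refine Eventually.of_forall fun x => ?_
    simp [cameronMartin, ENNReal.toReal_ofReal (Real.exp_pos _).le]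
  conv_rhs => rw [← Measure.map_id (μ := gaussianReal ⟪u, v⟫ (‖u‖₊ ^ 2))]
  refine map_eq_of_mgf_eq (h.measurable u).aemeasurable aemeasurable_id hi (funext fun t => ?_)
  rw [mgf_id_gaussianReal, mgf, h.integral_shiftMeasure, integral_congr_ae (e t), h.integral_exp]
  rw [norm_add_sq_real, inner_smul_right, norm_smul, real_inner_comm]
  push_cast
  rw [mul_pow, Real.norm_eq_abs, sq_abs]
  ring_nf

theorem eq_shiftMeasure (h : IsIsonormal W p) {q : Measure X} [IsFiniteMeasure q] (hq : q ≪ p)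
    (v : V) (hl : ∀ u, q.map (W u) = gaussianReal ⟪u, v⟫ (‖u‖₊ ^ 2)) : q = shiftMeasure W p v := by
  have := h.isProbabilityMeasure_shiftMeasure v
  exact h.ext hq (shiftMeasure_absolutelyContinuous W p v) fun u => by rw [hl, h.map_shiftMeasure]

theorem measurable_halfDensity (h : IsIsonormal W p) (v : V) : Measurable (halfDensity W v) :=
  (((h.measurable v).div_const 2).sub_const _).exp

theorem halfDensity_mul_ae (h : IsIsonormal W p) (u v : V) :
    (fun x => halfDensity W u x * halfDensity W v x) =ᵐ[p]
      fun x => Real.exp (W ((2⁻¹ : ℝ) • (u + v)) x + (-(‖u‖ ^ 2 / 4) - ‖v‖ ^ 2 / 4)) := by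
  filter_upwards [h.smul_ae (2⁻¹ : ℝ) (u + v), h.add_ae u v] with x h1 h2
  rw [h1, halfDensity, halfDensity, ← Real.exp_add, Pi.smul_apply, h2, Pi.add_apply, smul_eq_mul]
  ring_nf

theorem memLp_halfDensity (h : IsIsonormal W p) (v : V) : MemLp (halfDensity W v) 2 p := by
  rw [memLp_two_iff_integrable_sq (h.measurable_halfDensity v).aestronglyMeasurable]
  refine (h.integrable_exp _ _).congr ((h.halfDensity_mul_ae v v).symm.trans ?_)
  exact Eventually.of_forall fun x => (sq _).symm

/-- The square root of the density of the Cameron-Martin shift by `v`, as a vector of `L²`. -/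
noncomputable def halfVec (h : IsIsonormal W p) (v : V) : Lp ℝ 2 p := (h.memLp_halfDensity v).toLp _

/-- The product of the half-densities is the exponential of `W ((u + v) / 2)` up to a constant, and
`‖u + v‖² / 8 - ‖u‖² / 4 - ‖v‖² / 4 = -‖u - v‖² / 8`. This is the origin of the `1 / 8`. -/
theorem inner_halfVec (h : IsIsonormal W p) (u v : V) :
    ⟪h.halfVec u, h.halfVec v⟫ = Real.exp (-(‖u - v‖ ^ 2) / 8) := by
  rw [L2.inner_def]
  have : (fun x => ⟪h.halfVec u x, h.halfVec v x⟫) =ᵐ[p]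
      fun x => halfDensity W u x * halfDensity W v x := by
    filter_upwards [(h.memLp_halfDensity u).coeFn_toLp, (h.memLp_halfDensity v).coeFn_toLp]
      with x h1 h2
    rw [halfVec, halfVec, h1, h2, real_inner_eq_re_inner, mul_comm]
    rfl
  rw [integral_congr_ae (this.trans (h.halfDensity_mul_ae u v)), h.integral_exp]
  rw [norm_smul, mul_pow, norm_add_sq_real, norm_sub_sq_real]
  norm_num
  ring

/-- Orthogonality says that the finite measures with densities `F⁺` and `F⁻` give all exponentials
of `W` the same integral. They coincide by `ext`, hence `F⁺ = F⁻` almost everywhere. -/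
theorem eq_zero_of_inner_halfVec (h : IsIsonormal W p) (F : Lp ℝ 2 p)
    (hF : ∀ v, ⟪h.halfVec v, F⟫ = 0) : F = 0 := by
  have := h.isProbabilityMeasure
  have hFm : Measurable F := (Lp.stronglyMeasurable F).measurable
  have hexp : ∀ v (t : ℝ), MemLp (fun x => Real.exp (t * W v x)) 2 p := fun v t => by
    rw [memLp_two_iff_integrable_sq (by have := h.measurable v; fun_prop)]
    refine (h.integrable_exp_mul v (2 * t)).congr (Eventually.of_forall fun x => ?_)
    simp only [sq, ← Real.exp_add]
    ring_nf
  have hint : ∀ v (t : ℝ), Integrable (fun x => Real.exp (t * W v x) * F x) p := fun v t =>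
    (hexp v t).integrable_mul (Lp.memLp F)
  have h0 : ∀ v (t : ℝ), ∫ x, Real.exp (t * W v x) * F x ∂p = 0 := fun v t => by
    -- The factor `2` undoes the `W v / 2` in the half-density.
    have h1 := hF ((2 * t) • v)
    rw [L2.inner_def] at h1
    have : (fun x => ⟪h.halfVec ((2 * t) • v) x, F x⟫) =ᵐ[p]
        fun x => Real.exp (-(‖(2 * t) • v‖ ^ 2 / 4)) * (Real.exp (t * W v x) * F x) := by
      filter_upwards [(h.memLp_halfDensity ((2 * t) • v)).coeFn_toLp, h.smul_ae (2 * t) v]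
        with x h1 h2
      rw [halfVec, h1, halfDensity, h2, ← mul_assoc, ← Real.exp_add, real_inner_eq_re_inner,
        RCLike.inner_apply', conj_trivial, RCLike.re_to_real, Pi.smul_apply, smul_eq_mul]
      congr 2
      ring
    rw [integral_congr_ae this, integral_const_mul] at h1
    exact (mul_eq_zero.1 h1).resolve_left (Real.exp_pos _).ne'
  set q₁ := p.withDensity fun x => ENNReal.ofReal (F x) with hq₁
  set q₂ := p.withDensity fun x => ENNReal.ofReal (-F x) with hq₂
  have hf₁ : IsFiniteMeasure q₁ := isFiniteMeasure_withDensity_ofReal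
    ((Lp.memLp F).integrable (by norm_num)).2
  have hf₂ : IsFiniteMeasure q₂ := isFiniteMeasure_withDensity_ofReal
    ((Lp.memLp F).integrable (by norm_num)).neg.2
  have hi₁ : ∀ v (t : ℝ), Integrable (fun x => Real.exp (t * W v x) * max (F x) 0) p := fun v t => by
    refine (hint v t).pos_part.congr (Eventually.of_forall fun x => ?_)
    simp [mul_max_of_nonneg _ _ (Real.exp_pos (t * W v x)).le]
  have hi₂ : ∀ v (t : ℝ), Integrable (fun x => Real.exp (t * W v x) * max (-F x) 0) p :=
    fun v t => by
    refine (hint v t).neg_part.congr (Eventually.of_forall fun x => ?_)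
    simp [mul_max_of_nonneg _ _ (Real.exp_pos (t * W v x)).le]
  have key : q₁ = q₂ := by
    refine h.ext (withDensity_absolutelyContinuous _ _) (withDensity_absolutelyContinuous _ _)
      fun v => ?_
    refine map_eq_of_mgf_eq (h.measurable v).aemeasurable (h.measurable v).aemeasurable
      (fun t => ?_) (funext fun t => ?_)
    · rw [hq₁, integrable_withDensity_iff_integrable_smul' hFm.ennreal_ofReal (by simp)]
      refine (hi₁ v t).congr (Eventually.of_forall fun x => ?_)
      simp [ENNReal.toReal_ofReal', mul_comm]
    · rw [mgf, mgf, hq₁, hq₂, integral_withDensity_eq_integral_toReal_smul hFm.ennreal_ofReal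
        (by simp), integral_withDensity_eq_integral_toReal_smul (f := fun x => ENNReal.ofReal (-F x))
        hFm.neg.ennreal_ofReal (by simp),
        ← sub_eq_zero, ← h0 v t, ← integral_sub]
      · refine integral_congr_ae (Eventually.of_forall fun x => ?_)
        simp only [ENNReal.toReal_ofReal', smul_eq_mul, ← sub_mul]
        rw [mul_comm, max_zero_sub_max_neg_zero_eq_self]
      · refine (hi₁ v t).congr (Eventually.of_forall fun x => ?_)
        simp [ENNReal.toReal_ofReal', mul_comm]
      · refine (hi₂ v t).congr (Eventually.of_forall fun x => ?_)
        simp [ENNReal.toReal_ofReal', mul_comm]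
  have := (withDensity_eq_iff hFm.ennreal_ofReal.aemeasurable hFm.neg.ennreal_ofReal.aemeasurable
    (by simpa [hq₁] using (measure_lt_top q₁ Set.univ).ne)).1 key
  refine (Lp.eq_zero_iff_ae_eq_zero).2 (this.mono fun x hx => ?_)
  have := congrArg ENNReal.toReal hx
  simp only [ENNReal.toReal_ofReal'] at this
  rw [← max_zero_sub_max_neg_zero_eq_self (F x), this]
  exact sub_self _

theorem span_halfVec (h : IsIsonormal W p) :
    (Submodule.span ℝ (Set.range h.halfVec)).topologicalClosure = ⊤ := by
  rw [Submodule.topologicalClosure_eq_top_iff, Submodule.eq_bot_iff]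
  intro F hF
  refine h.eq_zero_of_inner_halfVec F fun v => ?_
  exact (Submodule.mem_orthogonal _ _).1 hF _ (Submodule.subset_span ⟨v, rfl⟩)

end IsIsonormal

/-! ### The law of the random walk -/

section Walk

theorem walk_succ {G : Type*} [Group G] (n : ℕ) (ω : ℕ → G) : walk (n + 1) ω = walk n ω * ω n := by
  simp [walk, List.range_succ]

variable {G : Type*} [Group G] [MeasurableSpace G]

/-- Makes `g_n` independent of the increment `ω n`, as used in `walkLaw_succ`. -/
theorem walk_eq_restrict (n : ℕ) : ∃ F : (Finset.range n → G) → G,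
    (∀ [MeasurableMul₂ G], Measurable F) ∧ ∀ ω : ℕ → G, walk n ω = F ((Finset.range n).restrict ω) := by
  induction n with
  | zero => exact ⟨fun _ => 1, @fun _ => measurable_const, fun ω => rfl⟩
  | succ n ih =>
    obtain ⟨F, hF, hF'⟩ := ih
    refine ⟨fun ω => F (fun i => ω ⟨i, by have := Finset.mem_range.1 i.2; simp; omega⟩)
      * ω ⟨n, by simp⟩, ?_, fun ω => ?_⟩
    · intro _
      have := @hF _
      fun_prop
    · rw [walk_succ, hF']
      rfl

variable [MeasurableMul₂ G]

theorem measurable_walk (n : ℕ) : Measurable (walk (G := G) n) := by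
  obtain ⟨F, hF, hF'⟩ := walk_eq_restrict (G := G) n
  rw [funext hF']
  have := @hF _
  fun_prop

/-- The law of the position after `n` steps of the `μ`-random walk. -/
noncomputable def walkLaw (μ : Measure G) (n : ℕ) : Measure G :=
  (Measure.infinitePi fun _ : ℕ => μ).map (walk n)

variable (μ : Measure G)

instance [IsProbabilityMeasure μ] (n : ℕ) : IsProbabilityMeasure (walkLaw μ n) :=
  Measure.isProbabilityMeasure_map (measurable_walk n).aemeasurable

theorem walkExpectation_eq (n : ℕ) {F : G → ℝ} (hF : Measurable F) :
    walkExpectation μ n F = ∫ g, F g ∂(walkLaw μ n) := by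
  rw [walkLaw, integral_map (measurable_walk n).aemeasurable hF.aestronglyMeasurable]
  rfl

variable [IsProbabilityMeasure μ]

omit [MeasurableMul₂ G] in
theorem walkLaw_zero : walkLaw μ 0 = Measure.dirac 1 := by
  rw [walkLaw, show walk (G := G) 0 = fun _ => 1 from rfl, Measure.map_const, measure_univ, one_smul]

theorem walkLaw_succ (n : ℕ) :
    walkLaw μ (n + 1) = ((walkLaw μ n).prod μ).map (fun x => x.1 * x.2) := by
  have hi : iIndepFun (fun (i : ℕ) (ω : ℕ → G) => ω i) (Measure.infinitePi fun _ : ℕ => μ) :=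
    iIndepFun_infinitePi (X := fun _ x => x) (fun _ => measurable_id)
  have h1 := hi.indepFun_finset (Finset.range n) {n} (by simp) (fun i => measurable_pi_apply i)
  obtain ⟨F, hF, hF'⟩ := walk_eq_restrict (G := G) n
  have hn : Measurable fun x : ({n} : Finset ℕ) → G => x ⟨n, by simp⟩ := by fun_prop
  have h2 := h1.comp hF hn
  have h3 : IndepFun (walk n) (fun ω : ℕ → G => ω n) (Measure.infinitePi fun _ : ℕ => μ) := by
    rw [funext hF']
    exact h2
  have h4 := (indepFun_iff_map_prod_eq_prod_map_map (measurable_walk n).aemeasurable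
    (measurable_pi_apply n).aemeasurable).1 h3
  have h5 : (Measure.infinitePi fun _ : ℕ => μ).map (fun ω : ℕ → G => ω n) = μ :=
    Measure.infinitePi_map_eval (fun _ : ℕ => μ) n
  rw [h5] at h4
  rw [walkLaw, walkLaw, ← h4, Measure.map_map (by fun_prop)
    ((measurable_walk n).prodMk (measurable_pi_apply n))]
  congr 1
  exact funext fun ω => walk_succ n ω

theorem integral_walkLaw_succ (n : ℕ) {F : G → ℝ} (hF : Measurable F) {C : ℝ}
    (hC : ∀ g, |F g| ≤ C) :
    ∫ g, F g ∂(walkLaw μ (n + 1)) = ∫ g, ∫ h, F (g * h) ∂μ ∂(walkLaw μ n) := by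
  rw [walkLaw_succ, integral_map (by fun_prop) hF.aestronglyMeasurable, integral_prod]
  exact Integrable.of_bound (hF.comp (by fun_prop)).aestronglyMeasurable C (Eventually.of_forall fun x => hC _)

theorem walkLaw_one : walkLaw μ 1 = μ := by
  rw [walkLaw_succ, walkLaw_zero, Measure.dirac_prod, Measure.map_map (by fun_prop) (by fun_prop)]
  simp [Function.comp_def]

end Walk

/-! ### Symmetric operators -/

section Symmetric

variable {H : Type*} [NormedAddCommGroup H] [InnerProductSpace ℝ H] {T : H →L[ℝ] H}

theorem inner_pow_of_symm (hT : ∀ ξ η, ⟪T ξ, η⟫ = ⟪ξ, T η⟫) (n : ℕ) (ξ η : H) :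
    ⟪(T ^ n) ξ, η⟫ = ⟪ξ, (T ^ n) η⟫ := by
  induction n generalizing ξ η with
  | zero => rfl
  | succ n ih =>
    rw [pow_succ, mul_apply_eq_comp, ih, hT, ← mul_apply_eq_comp, ← pow_succ', ← pow_succ]

theorem inner_pow_two_mul_of_symm (hT : ∀ ξ η, ⟪T ξ, η⟫ = ⟪ξ, T η⟫) (n : ℕ) (η : H) :
    ⟪(T ^ (2 * n)) η, η⟫ = ‖(T ^ n) η‖ ^ 2 := by
  rw [two_mul, pow_add, mul_apply_eq_comp, inner_pow_of_symm hT,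
    real_inner_self_eq_norm_sq]

/-- Since `‖Tⁿ⁺¹ η‖² = ⟪Tⁿ η, Tⁿ⁺² η⟫`, the sequence `‖Tⁿ η‖` is log-convex, so its successive
ratios never fall below the first one. This replaces the spectral theorem. -/
theorem norm_mul_norm_pow_le (hT : ∀ ξ η, ⟪T ξ, η⟫ = ⟪ξ, T η⟫) (n : ℕ) (η : H) :
    ‖T η‖ * ‖(T ^ n) η‖ ≤ ‖η‖ * ‖(T ^ (n + 1)) η‖ := by
  have hlog : ∀ n, ‖(T ^ (n + 1)) η‖ ^ 2 ≤ ‖(T ^ n) η‖ * ‖(T ^ (n + 2)) η‖ := fun n => by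
    rw [← real_inner_self_eq_norm_sq, pow_succ', mul_apply_eq_comp, hT,
      ← mul_apply_eq_comp, ← mul_apply_eq_comp, ← sq, ← pow_add, add_comm 2 n]
    exact real_inner_le_norm _ _
  induction n with
  | zero => simp [mul_comm]
  | succ n ih =>
    rcases (norm_nonneg ((T ^ n) η)).eq_or_lt with h0 | h0
    · have h1 := hlog n
      rw [← h0, zero_mul] at h1
      have h2 : ‖(T ^ (n + 1)) η‖ = 0 := by
        simpa using le_antisymm h1 (sq_nonneg _)
      rw [h2, mul_zero]
      positivity
    · refine le_of_mul_le_mul_left ?_ h0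
      calc ‖(T ^ n) η‖ * (‖T η‖ * ‖(T ^ (n + 1)) η‖)
          = (‖T η‖ * ‖(T ^ n) η‖) * ‖(T ^ (n + 1)) η‖ := by ring
        _ ≤ (‖η‖ * ‖(T ^ (n + 1)) η‖) * ‖(T ^ (n + 1)) η‖ := by gcongr
        _ = ‖η‖ * ‖(T ^ (n + 1)) η‖ ^ 2 := by ring
        _ ≤ ‖η‖ * (‖(T ^ n) η‖ * ‖(T ^ (n + 2)) η‖) := by gcongr; exact hlog n
        _ = ‖(T ^ n) η‖ * (‖η‖ * ‖(T ^ (n + 1 + 1)) η‖) := by ring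

theorem pow_mul_norm_le (hT : ∀ ξ η, ⟪T ξ, η⟫ = ⟪ξ, T η⟫) {r : ℝ} (hr : 0 ≤ r) {η : H}
    (h : r * ‖η‖ ≤ ‖T η‖) (n : ℕ) : r ^ n * ‖η‖ ≤ ‖(T ^ n) η‖ := by
  rcases (norm_nonneg η).eq_or_lt with h0 | h0
  · rw [← h0, mul_zero]
    exact norm_nonneg _
  induction n with
  | zero => simp
  | succ n ih =>
    refine le_of_mul_le_mul_left ?_ h0
    calc ‖η‖ * (r ^ (n + 1) * ‖η‖) = (r * ‖η‖) * (r ^ n * ‖η‖) := by ring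
      _ ≤ ‖T η‖ * ‖(T ^ n) η‖ := by gcongr
      _ ≤ _ := norm_mul_norm_pow_le hT n η

end Symmetric

/-! ### Orthogonal representations and averaged operators -/

/-- `U` is a weakly continuous orthogonal representation of `G`. -/
structure IsOrthogonalRep {G H : Type*} [Group G] [TopologicalSpace G] [NormedAddCommGroup H]
    [InnerProductSpace ℝ H] (U : G → H →L[ℝ] H) : Prop where
  one : ∀ ξ, U 1 ξ = ξ
  mul : ∀ g h ξ, U (g * h) ξ = U g (U h ξ)
  adjoint : ∀ g ξ η, ⟪U g ξ, η⟫ = ⟪ξ, U g⁻¹ η⟫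
  continuous : ∀ ξ η, Continuous fun g => ⟪U g ξ, η⟫

/-- `T` is the weak integral of `U` against `μ`. -/
def IsWeakIntegral {G H : Type*} [MeasurableSpace G] [NormedAddCommGroup H]
    [InnerProductSpace ℝ H] (U : G → H →L[ℝ] H) (μ : Measure G) (T : H →L[ℝ] H) : Prop :=
  ∀ ξ η : H, Integrable (fun g => ⟪U g ξ, η⟫) μ ∧ ⟪T ξ, η⟫ = ∫ g, ⟪U g ξ, η⟫ ∂μ

namespace IsOrthogonalRep

variable {G H : Type*} [Group G] [TopologicalSpace G] [NormedAddCommGroup H]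
    [InnerProductSpace ℝ H] {U : G → H →L[ℝ] H}

theorem norm_map (hU : IsOrthogonalRep U) (g : G) (ξ : H) : ‖U g ξ‖ = ‖ξ‖ := by
  rw [← sq_eq_sq₀ (norm_nonneg _) (norm_nonneg _), ← real_inner_self_eq_norm_sq, hU.adjoint,
    ← hU.mul, inv_mul_cancel, hU.one, real_inner_self_eq_norm_sq]

theorem abs_inner_le (hU : IsOrthogonalRep U) (g : G) (ξ η : H) : |⟪U g ξ, η⟫| ≤ ‖ξ‖ * ‖η‖ := by
  rw [← hU.norm_map g ξ]
  exact abs_real_inner_le_norm _ _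

/-- For isometries weak continuity is strong continuity: `‖U g ξ - ξ‖² = 2 ‖ξ‖² - 2 ⟪U g ξ, ξ⟫`. -/
theorem tendsto_norm_sub (hU : IsOrthogonalRep U) (ξ : H) :
    Tendsto (fun g => ‖U g ξ - ξ‖) (𝓝 1) (𝓝 0) := by
  have h1 : ∀ g, ‖U g ξ - ξ‖ = Real.sqrt (2 * ‖ξ‖ ^ 2 - 2 * ⟪U g ξ, ξ⟫) := fun g => by
    rw [← Real.sqrt_sq (norm_nonneg (U g ξ - ξ)), norm_sub_sq_real, hU.norm_map]
    ring_nf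
  simp_rw [h1]
  have h2 : Continuous fun g => Real.sqrt (2 * ‖ξ‖ ^ 2 - 2 * ⟪U g ξ, ξ⟫) := by
    have := hU.continuous ξ ξ
    fun_prop
  have h3 := h2.tendsto 1
  rwa [hU.one, real_inner_self_eq_norm_sq, sub_self, Real.sqrt_zero] at h3

variable [MeasurableSpace G] [OpensMeasurableSpace G]

theorem measurable_inner (hU : IsOrthogonalRep U) (ξ η : H) : Measurable fun g => ⟪U g ξ, η⟫ :=
  (hU.continuous ξ η).measurable

theorem integrable_inner (hU : IsOrthogonalRep U) (μ : Measure G) [IsFiniteMeasure μ] (ξ η : H) :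
    Integrable (fun g => ⟪U g ξ, η⟫) μ :=
  Integrable.of_bound (hU.measurable_inner ξ η).aestronglyMeasurable (‖ξ‖ * ‖η‖)
    (Eventually.of_forall fun g => hU.abs_inner_le g ξ η)

/-- The averaged coefficients form a bilinear form bounded by `1`, which Riesz representation turns
into an operator. Testing it against `T ξ` gives the norm bound. -/
theorem exists_isWeakIntegral [CompleteSpace H] (hU : IsOrthogonalRep U) (μ : Measure G)
    [IsProbabilityMeasure μ] : ∃ T : H →L[ℝ] H, IsWeakIntegral U μ T ∧ ‖T‖ ≤ 1 := by
  have hb : ∀ ξ η : H, ‖∫ g, ⟪U g ξ, η⟫ ∂μ‖ ≤ 1 * ‖ξ‖ * ‖η‖ := fun ξ η => by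
    have := norm_integral_le_of_norm_le_const (μ := μ) (f := fun g => ⟪U g ξ, η⟫)
      (Eventually.of_forall fun g => hU.abs_inner_le g ξ η)
    simpa using this
  let B : H →L[ℝ] H →L[ℝ] ℝ := LinearMap.mkContinuous₂
    (LinearMap.mk₂ ℝ (fun ξ η => ∫ g, ⟪U g ξ, η⟫ ∂μ)
      (fun ξ ξ' η => by
        simp only [map_add, inner_add_left]
        exact integral_add (hU.integrable_inner μ _ _) (hU.integrable_inner μ _ _))
      (fun c ξ η => by simp [inner_smul_left, integral_const_mul])
      (fun ξ η η' => by
        simp only [inner_add_right]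
        exact integral_add (hU.integrable_inner μ _ _) (hU.integrable_inner μ _ _))
      (fun c ξ η => by simp [inner_smul_right, integral_const_mul])) 1 hb
  have hT : ∀ ξ η, ⟪InnerProductSpace.continuousLinearMapOfBilin (𝕜 := ℝ) B ξ, η⟫
      = ∫ g, ⟪U g ξ, η⟫ ∂μ := fun ξ η => InnerProductSpace.continuousLinearMapOfBilin_apply B ξ η
  refine ⟨InnerProductSpace.continuousLinearMapOfBilin (𝕜 := ℝ) B,
    fun ξ η => ⟨hU.integrable_inner μ ξ η, hT ξ η⟩, ?_⟩
  refine ContinuousLinearMap.opNorm_le_bound _ zero_le_one fun ξ => ?_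
  set T := InnerProductSpace.continuousLinearMapOfBilin (𝕜 := ℝ) B
  rcases (norm_nonneg (T ξ)).eq_or_lt with h0 | h0
  · rw [← h0]
    positivity
  refine le_of_mul_le_mul_right ?_ h0
  have := hb ξ (T ξ)
  rw [← hT, real_inner_self_eq_norm_sq, Real.norm_of_nonneg (sq_nonneg _), sq] at this
  exact this

variable {μ : Measure G} {T : H →L[ℝ] H}

theorem symm_of_isWeakIntegral [MeasurableInv G] (hU : IsOrthogonalRep U) (hT : IsWeakIntegral U μ T)
    (hμ : μ.map (fun g => g⁻¹) = μ) (ξ η : H) : ⟪T ξ, η⟫ = ⟪ξ, T η⟫ := by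
  rw [(hT ξ η).2, real_inner_comm, (hT η ξ).2]
  conv_lhs => rw [← hμ]
  rw [integral_map measurable_inv.aemeasurable (hU.measurable_inner ξ η).aestronglyMeasurable]
  refine integral_congr_ae (Eventually.of_forall fun g => ?_)
  simp only
  rw [hU.adjoint, inv_inv, real_inner_comm]

theorem inner_pow [MeasurableMul₂ G] [IsProbabilityMeasure μ] (hU : IsOrthogonalRep U)
    (hT : IsWeakIntegral U μ T) (n : ℕ) (ξ η : H) :
    ⟪(T ^ n) ξ, η⟫ = ∫ g, ⟪U g ξ, η⟫ ∂(walkLaw μ n) := by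
  induction n generalizing ξ with
  | zero =>
    rw [walkLaw_zero, integral_dirac' _ _ (hU.measurable_inner ξ η).stronglyMeasurable, hU.one]
    rfl
  | succ n ih =>
    rw [pow_succ, mul_apply_eq_comp, ih,
      integral_walkLaw_succ μ n (hU.measurable_inner ξ η) (fun g => hU.abs_inner_le g ξ η)]
    refine integral_congr_ae (Eventually.of_forall fun g => ?_)
    simp only [hU.mul]
    rw [hU.adjoint, (hT _ _).2]
    refine integral_congr_ae (Eventually.of_forall fun h => ?_)
    simp only
    rw [hU.adjoint g]

/-- Some `η` in the dense set satisfies `r ‖η‖ < ‖T η‖`, and then `r²ⁿ ‖η‖² ≤ ‖Tⁿ η‖² = ⟪T²ⁿ η, η⟫`,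
the average of a coefficient dominated by `φ`. Even times appear because there the coefficient is a
squared norm. It serves both for Gaussian kernels and for the regular representation. -/
theorem exists_pow_le_integral [MeasurableMul₂ G] [MeasurableInv G] [IsProbabilityMeasure μ]
    (hU : IsOrthogonalRep U) (hT : IsWeakIntegral U μ T) (hμ : μ.map (fun g => g⁻¹) = μ)
    {D : Set H} (hD : Dense D) {φ : G → ℝ} (hφ : ∀ n, Integrable φ (walkLaw μ n))
    (h : ∀ η ∈ D, ∃ C, 0 < C ∧ ∀ g, ⟪U g η, η⟫ ≤ C * φ g) {r : ℝ} (hr : 0 ≤ r) (hrT : r < ‖T‖) :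
    ∃ c, 0 < c ∧ ∀ n, c * r ^ (2 * n) ≤ ∫ g, φ g ∂(walkLaw μ (2 * n)) := by
  obtain ⟨η, hηD, hη⟩ : ∃ η ∈ D, r * ‖η‖ < ‖T η‖ := by
    by_contra! hcon
    refine hrT.not_ge (ContinuousLinearMap.opNorm_le_bound _ hr fun ξ => ?_)
    have hcl : IsClosed {ξ | ‖T ξ‖ ≤ r * ‖ξ‖} := isClosed_le (by fun_prop) (by fun_prop)
    have := hcl.closure_subset_iff.2 (fun ξ hξ => hcon ξ hξ)
    rw [hD.closure_eq] at this
    exact this (Set.mem_univ ξ)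
  have hη0 : 0 < ‖η‖ := by
    rw [norm_pos_iff]
    rintro rfl
    simp at hη
  have hs := hU.symm_of_isWeakIntegral hT hμ
  obtain ⟨C, hC, hCφ⟩ := h η hηD
  refine ⟨‖η‖ ^ 2 / C, by positivity, fun n => ?_⟩
  rw [div_mul_eq_mul_div, div_le_iff₀ hC, mul_comm _ C, ← integral_const_mul]
  calc ‖η‖ ^ 2 * r ^ (2 * n) = (r ^ n * ‖η‖) ^ 2 := by ring
    _ ≤ ‖(T ^ n) η‖ ^ 2 := by gcongr; exact pow_mul_norm_le hs hr hη.le n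
    _ = ∫ g, ⟪U g η, η⟫ ∂(walkLaw μ (2 * n)) := by
      rw [← inner_pow_two_mul_of_symm hs, hU.inner_pow hT]
    _ ≤ _ := integral_mono (hU.integrable_inner _ _ _) ((hφ _).const_mul C) hCφ

end IsOrthogonalRep

/-! ### Laplace transforms of length functions along the random walk -/

/-- The expectation of `exp (-s ℓ(g_n)²)`. -/
noncomputable def walkLaplace {G : Type*} [Group G] [MeasurableSpace G] (μ : Measure G) (ℓ : G → ℝ)
    (n : ℕ) (s : ℝ) : ℝ :=
  walkExpectation μ n fun g => Real.exp (-s * ℓ g ^ 2)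

section Laplace

variable {G : Type*} [Group G] [MeasurableSpace G] [MeasurableMul₂ G] {μ : Measure G}
  [IsProbabilityMeasure μ] {ℓ : G → ℝ}

omit [IsProbabilityMeasure μ] in
theorem walkLaplace_eq (hℓ : Measurable ℓ) (n : ℕ) (s : ℝ) :
    walkLaplace μ ℓ n s = ∫ g, Real.exp (-s * ℓ g ^ 2) ∂(walkLaw μ n) :=
  walkExpectation_eq μ n (by fun_prop)

theorem exp_neg_mul_sq_le_one {s : ℝ} (hs : 0 ≤ s) (x : ℝ) : Real.exp (-s * x ^ 2) ≤ 1 := by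
  rw [Real.exp_le_one_iff]
  nlinarith [mul_nonneg hs (sq_nonneg x)]

theorem integrable_exp_neg_mul_sq_comp {G : Type*} [MeasurableSpace G] {ℓ : G → ℝ} (hℓ : Measurable ℓ)
    (ν : Measure G) [IsFiniteMeasure ν] {s : ℝ} (hs : 0 ≤ s) :
    Integrable (fun g => Real.exp (-s * ℓ g ^ 2)) ν :=
  Integrable.of_bound (by fun_prop) 1 (Eventually.of_forall fun g => by
    rw [Real.norm_of_nonneg (Real.exp_pos _).le]
    exact exp_neg_mul_sq_le_one hs _)

theorem walkLaplace_zero (hℓ : Measurable ℓ) (n : ℕ) : walkLaplace μ ℓ n 0 = 1 := by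
  simp [walkLaplace_eq hℓ]

theorem walkLaplace_pos (hℓ : Measurable ℓ) (n : ℕ) {s : ℝ} (hs : 0 ≤ s) :
    0 < walkLaplace μ ℓ n s := by
  rw [walkLaplace_eq hℓ]
  exact integral_exp_pos (integrable_exp_neg_mul_sq_comp hℓ _ hs)

theorem walkLaplace_anti (hℓ : Measurable ℓ) (n : ℕ) {s t : ℝ} (hs : 0 ≤ s) (hst : s ≤ t) :
    walkLaplace μ ℓ n t ≤ walkLaplace μ ℓ n s := by
  rw [walkLaplace_eq hℓ, walkLaplace_eq hℓ]
  refine integral_mono (integrable_exp_neg_mul_sq_comp hℓ _ (hs.trans hst))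
    (integrable_exp_neg_mul_sq_comp hℓ _ hs) fun g => ?_
  simp only [Real.exp_le_exp]
  nlinarith [mul_le_mul_of_nonneg_right hst (sq_nonneg (ℓ g))]

theorem convexOn_log_walkLaplace (hℓ : Measurable ℓ) (n : ℕ) :
    ConvexOn ℝ (Set.Ici 0) fun s => Real.log (walkLaplace μ ℓ n s) := by
  refine convexOn_iff_forall_pos.2 ⟨convex_Ici 0, fun s hs t ht a b ha hb hab => ?_⟩
  have hs' : (0 : ℝ) ≤ s := hs
  have ht' : (0 : ℝ) ≤ t := ht
  have hst : 0 ≤ a * s + b * t := by positivity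
  have hsp := walkLaplace_pos (μ := μ) hℓ n hs'
  have htp := walkLaplace_pos (μ := μ) hℓ n ht'
  have key : walkLaplace μ ℓ n (a * s + b * t)
      ≤ walkLaplace μ ℓ n s ^ a * walkLaplace μ ℓ n t ^ b := by
    -- Log-convexity is Hölder's inequality with exponents `1 / a` and `1 / b`.
    have hpq : (a⁻¹).HolderConjugate b⁻¹ := by
      rw [Real.holderConjugate_iff]
      refine ⟨(one_lt_inv₀ ha).2 (by linarith), by simpa using hab⟩
    have hm : ∀ u c : ℝ, 0 ≤ u → 0 < c →
        MemLp (fun g => Real.exp (-(c * u) * ℓ g ^ 2)) (ENNReal.ofReal c⁻¹) (walkLaw μ n) :=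
      fun u c hu hc => MemLp.of_bound (by fun_prop) 1 (Eventually.of_forall fun g => by
        rw [Real.norm_of_nonneg (Real.exp_pos _).le]
        exact exp_neg_mul_sq_le_one (by positivity) _)
    have := integral_mul_le_Lp_mul_Lq_of_nonneg (μ := walkLaw μ n) hpq
      (f := fun g => Real.exp (-(a * s) * ℓ g ^ 2)) (g := fun g => Real.exp (-(b * t) * ℓ g ^ 2))
      (Eventually.of_forall fun g => (Real.exp_pos _).le)
      (Eventually.of_forall fun g => (Real.exp_pos _).le) (hm s a hs' ha) (hm t b ht' hb)
    rw [walkLaplace_eq hℓ, walkLaplace_eq hℓ, walkLaplace_eq hℓ]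
    have e : ∀ u c : ℝ, 0 < c → ∀ g, Real.exp (-(c * u) * ℓ g ^ 2) ^ c⁻¹
        = Real.exp (-u * ℓ g ^ 2) := fun u c hc g => by
      rw [← Real.exp_mul]
      congr 1
      field_simp
    simp only [e _ _ ha, e _ _ hb, one_div, inv_inv, ← Real.exp_add] at this
    refine le_trans (le_of_eq (integral_congr_ae (Eventually.of_forall fun g => ?_))) this
    simp only
    ring_nf
  simp only [smul_eq_mul]
  rw [← Real.log_rpow hsp, ← Real.log_rpow htp, ← Real.log_mul (by positivity) (by positivity)]
  exact Real.log_le_log (walkLaplace_pos hℓ n hst) key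

/-- Log-convexity between `s` and `0`, where the Laplace transform equals `1`. -/
theorem walkLaplace_mul_le_rpow (hℓ : Measurable ℓ) (n : ℕ) {s c : ℝ} (hs : 0 ≤ s) (hc : 0 ≤ c)
    (hc1 : c ≤ 1) : walkLaplace μ ℓ n (c * s) ≤ walkLaplace μ ℓ n s ^ c := by
  have hsp := walkLaplace_pos (μ := μ) hℓ n hs
  have := (convexOn_log_walkLaplace (μ := μ) hℓ n).2 (x := s) (y := 0) hs (Set.mem_Ici.2 le_rfl)
    hc (sub_nonneg.2 hc1) (by ring)
  simp only [walkLaplace_zero hℓ, smul_eq_mul, Real.log_one, mul_zero, add_zero] at this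
  rwa [← Real.log_rpow hsp, Real.log_le_log_iff (walkLaplace_pos hℓ n (by positivity))
    (by positivity)] at this

theorem exists_mul_add_sq_le {c : ℝ} (hc : c < 1) (hc0 : 0 ≤ c) :
    ∃ C : ℝ, 0 ≤ C ∧ ∀ x y : ℝ, c * (x + y) ^ 2 ≤ x ^ 2 + C * y ^ 2 := by
  have h : 0 < 1 - c := sub_pos.2 hc
  -- This constant makes the difference of the two sides a perfect square divided by `1 - c`.
  refine ⟨c / (1 - c), by positivity, fun x y => ?_⟩
  have e : x ^ 2 + c / (1 - c) * y ^ 2 - c * (x + y) ^ 2 = ((1 - c) * x - c * y) ^ 2 / (1 - c) := by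
    field_simp
    ring
  have : 0 ≤ ((1 - c) * x - c * y) ^ 2 / (1 - c) := by positivity
  linarith

/-- Bridges even and odd times: one further step costs a constant factor and a shrinking of `s` to
`c s`. The constant is positive even if `ℓ²` is not `μ`-integrable. -/
theorem exists_mul_walkLaplace_le_succ (hℓ : Measurable ℓ) (h0 : ∀ g, 0 ≤ ℓ g)
    (hadd : ∀ g h, ℓ (g * h) ≤ ℓ g + ℓ h) {s c : ℝ} (hs : 0 ≤ s) (hc0 : 0 ≤ c) (hc : c < 1) :
    ∃ k, 0 < k ∧ ∀ n, k * walkLaplace μ ℓ n s ≤ walkLaplace μ ℓ (n + 1) (c * s) := by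
  obtain ⟨C, hC, hCx⟩ := exists_mul_add_sq_le hc hc0
  refine ⟨∫ h, Real.exp (-(s * C) * ℓ h ^ 2) ∂μ,
    integral_exp_pos (integrable_exp_neg_mul_sq_comp hℓ _ (by positivity)), fun n => ?_⟩
  have hcs : 0 ≤ c * s := by positivity
  rw [walkLaplace_eq hℓ, walkLaplace_eq hℓ, integral_walkLaw_succ μ n (C := 1) (by fun_prop),
    ← integral_const_mul]
  · refine integral_mono ((integrable_exp_neg_mul_sq_comp hℓ _ hs).const_mul _) ?_ fun g => ?_
    · refine Integrable.of_bound ?_ 1 (Eventually.of_forall fun g => ?_)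
      · refine (StronglyMeasurable.integral_prod_right' (f := fun x : G × G =>
          Real.exp (-(c * s) * ℓ (x.1 * x.2) ^ 2)) ?_).aestronglyMeasurable
        exact Measurable.stronglyMeasurable (by fun_prop)
      · have := norm_integral_le_of_norm_le_const (μ := μ) (C := 1)
          (f := fun h => Real.exp (-(c * s) * ℓ (g * h) ^ 2)) (Eventually.of_forall fun h => by
            rw [Real.norm_of_nonneg (Real.exp_pos _).le]
            exact exp_neg_mul_sq_le_one hcs _)
        simpa using this
    · simp only
      rw [mul_comm, ← integral_const_mul]
      refine integral_mono ((integrable_exp_neg_mul_sq_comp hℓ _ (by positivity)).const_mul _)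
        (integrable_exp_neg_mul_sq_comp (ℓ := fun h => ℓ (g * h)) (by fun_prop) _ hcs) fun h => ?_
      simp only [← Real.exp_add, Real.exp_le_exp]
      have h1 : ℓ (g * h) ^ 2 ≤ (ℓ g + ℓ h) ^ 2 := by
        gcongr
        · exact h0 _
        · exact hadd g h
      have h2 := hCx (ℓ g) (ℓ h)
      have h3 := mul_le_mul_of_nonneg_left h1 hc0
      nlinarith [mul_le_mul_of_nonneg_left (h3.trans h2) hs]
  · intro g
    rw [abs_of_pos (Real.exp_pos _)]
    exact exp_neg_mul_sq_le_one hcs _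

/-- The hypothesis `hge` carries one factor `c`, and reaching odd times costs a second.
`walkLaplace_mul_le_rpow` turns the parameter `c² s` into the power `c²`, which disappears as `c →
1`. -/
theorem tendsto_walkLaplace_rpow (hℓ : Measurable ℓ) (h0 : ∀ g, 0 ≤ ℓ g)
    (hadd : ∀ g h, ℓ (g * h) ≤ ℓ g + ℓ h) {s R : ℝ} (hs : 0 ≤ s) (hR : R ≤ 1)
    (hle : ∀ n, walkLaplace μ ℓ n s ≤ R ^ n)
    (hge : ∀ c r : ℝ, 0 < c → c < 1 → 0 ≤ r → r < R →
      ∃ k, 0 < k ∧ ∀ n, k * r ^ (2 * n) ≤ walkLaplace μ ℓ (2 * n) (c * s)) :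
    Tendsto (fun n : ℕ => walkLaplace μ ℓ n s ^ (1 / (n : ℝ))) atTop (𝓝 R) := by
  have hR0 : 0 < R := by
    have := (walkLaplace_pos (μ := μ) hℓ 1 hs).trans_le (hle 1)
    rwa [pow_one] at this
  have hpos := fun n => walkLaplace_pos (μ := μ) hℓ n hs
  have hbase : ∀ c r : ℝ, 0 < c → c < 1 → 0 < r → r < R →
      ∃ k, 0 < k ∧ ∀ n, k * r ^ n ≤ walkLaplace μ ℓ n (c * (c * s)) := fun c r hc hc1 hr hrR => by
    obtain ⟨k, hk, hkn⟩ := hge c r hc hc1 hr.le hrR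
    obtain ⟨k', hk', hkn'⟩ := exists_mul_walkLaplace_le_succ (μ := μ) hℓ h0 hadd
      (s := c * s) (by positivity) hc.le hc1
    refine ⟨min k (k' * k), by positivity, fun n => ?_⟩
    rcases Nat.even_or_odd' n with ⟨m, rfl | rfl⟩
    · calc min k (k' * k) * r ^ (2 * m) ≤ k * r ^ (2 * m) := by gcongr; exact min_le_left _ _
        _ ≤ _ := hkn m
        _ ≤ _ := walkLaplace_anti hℓ _ (by positivity)
          (mul_le_of_le_one_left (by positivity) hc1.le)
    · calc min k (k' * k) * r ^ (2 * m + 1) ≤ (k' * k) * r ^ (2 * m) := by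
            refine mul_le_mul (min_le_right _ _) ?_ (by positivity) (by positivity)
            exact pow_le_pow_of_le_one hr.le (hrR.le.trans hR) (Nat.le_succ _)
        _ = k' * (k * r ^ (2 * m)) := by ring
        _ ≤ k' * walkLaplace μ ℓ (2 * m) (c * s) := by gcongr; exact hkn m
        _ ≤ _ := hkn' _
  refine tendsto_order.2 ⟨fun q hq => ?_, fun q hq => ?_⟩
  -- The maximum with `0` keeps `r` positive when `q` is negative.
  · obtain ⟨r, hqr, hrR⟩ := exists_between (max_lt hq hR0)
    have hr0 : 0 < r := (le_max_right _ _).trans_lt hqr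
    have hqr' : q < r := (le_max_left _ _).trans_lt hqr
    -- As `c` increases to `1`, `r ^ (1 / c²)` tends to `r > q`; the exponent `1 / c²` inverts the
    -- power `c²` below.
    obtain ⟨c, hc, hc1, hcr⟩ : ∃ c : ℝ, 0 < c ∧ c < 1 ∧ q < r ^ (1 / (c * c)) := by
      have h1 : Tendsto (fun c : ℝ => r ^ (1 / (c * c))) (𝓝[<] 1) (𝓝 (r ^ (1 / ((1 : ℝ) * 1)))) := by
        refine Tendsto.mono_left ?_ nhdsWithin_le_nhds
        refine ContinuousAt.tendsto (f := fun c : ℝ => r ^ (1 / (c * c))) ?_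
        refine ContinuousAt.rpow continuousAt_const ?_ (Or.inl hr0.ne')
        exact continuousAt_const.div (by fun_prop) (by norm_num)
      rw [mul_one, div_one, Real.rpow_one] at h1
      have h2 : ∀ᶠ c : ℝ in 𝓝[<] 1, 0 < c :=
        nhdsWithin_le_nhds (lt_mem_nhds zero_lt_one)
      obtain ⟨c, ⟨hc, hc0⟩, hc1⟩ := ((h1.eventually (lt_mem_nhds hqr')).and h2).and
        self_mem_nhdsWithin |>.exists
      exact ⟨c, hc0, hc1, hc⟩
    obtain ⟨k, hk, hkn⟩ := hbase c r hc hc1 hr0 hrR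
    have hlim : Tendsto (fun n : ℕ => (k ^ (1 / (n : ℝ)) * r) ^ (1 / (c * c))) atTop
        (𝓝 ((k ^ (0 : ℝ) * r) ^ (1 / (c * c)))) := by
      have h1 : Tendsto (fun n : ℕ => k ^ (1 / (n : ℝ))) atTop (𝓝 (k ^ (0 : ℝ))) :=
        (tendsto_const_nhds (x := k)).rpow tendsto_one_div_atTop_nhds_zero_nat (Or.inl hk.ne')
      exact (h1.mul_const r).rpow_const (Or.inr (by positivity))
    rw [Real.rpow_zero, one_mul] at hlim
    filter_upwards [hlim.eventually (lt_mem_nhds hcr), eventually_gt_atTop 0] with n hn hn0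
    refine hn.trans_le ?_
    have hn0' : (0 : ℝ) < n := Nat.cast_pos.2 hn0
    have e1 : k ^ (1 / (n : ℝ)) * r = (k * r ^ n) ^ (1 / (n : ℝ)) := by
      rw [Real.mul_rpow hk.le (by positivity), ← Real.rpow_natCast r, ← Real.rpow_mul hr0.le,
        mul_one_div_cancel hn0'.ne', Real.rpow_one]
    have e2 : (k * r ^ n) ≤ walkLaplace μ ℓ n s ^ (c * c) := by
      refine (hkn n).trans ?_
      rw [← mul_assoc]
      exact walkLaplace_mul_le_rpow hℓ n hs (by positivity) (by nlinarith)
    calc (k ^ (1 / (n : ℝ)) * r) ^ (1 / (c * c))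
        ≤ ((walkLaplace μ ℓ n s ^ (c * c)) ^ (1 / (n : ℝ))) ^ (1 / (c * c)) := by
          rw [e1]
          gcongr
      _ = walkLaplace μ ℓ n s ^ (1 / (n : ℝ)) := by
          rw [← Real.rpow_mul (hpos n).le, ← Real.rpow_mul (hpos n).le]
          congr 1
          field_simp
  · filter_upwards [eventually_gt_atTop 0] with n hn0
    refine lt_of_le_of_lt ?_ hq
    calc walkLaplace μ ℓ n s ^ (1 / (n : ℝ)) ≤ (R ^ n) ^ (1 / (n : ℝ)) := by
          have := (hpos n).le
          gcongr
          exact hle n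
      _ = R := by
          rw [one_div]
          exact Real.pow_rpow_inv_natCast hR0.le hn0.ne'

end Laplace

/-! ### Representations carrying a Gaussian kernel -/

/-- The vectors `ξ a`, `a ∈ P`, are total and realize the kernel `exp (-d(a, b)² / 8)`. -/
structure IsGaussianKernel {P H : Type*} [MetricSpace P] [NormedAddCommGroup H]
    [InnerProductSpace ℝ H] (ξ : P → H) : Prop where
  inner : ∀ a b, ⟪ξ a, ξ b⟫ = Real.exp (-(dist a b ^ 2) / 8)
  dense : Dense (Submodule.span ℝ (Set.range ξ) : Set H)

/-! ### Displacement lengths of affine isometric actions. -/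

namespace AffineIsometricAction

variable {G V P : Type*} [Group G] [TopologicalSpace G] [NormedAddCommGroup V]
  [InnerProductSpace ℝ V] [MetricSpace P] [NormedAddTorsor V P] (β : AffineIsometricAction G P)

theorem hom_mul_apply (g h : G) (x : P) : β.hom (g * h) x = β.hom g (β.hom h x) := by
  rw [map_mul]
  rfl

theorem hom_one_apply (x : P) : β.hom 1 x = x := by
  rw [map_one]
  rfl

theorem dist_hom (g : G) (x y : P) : dist (β.hom g x) y = dist x (β.hom g⁻¹ y) := by
  rw [← (β.hom g).dist_map x, ← hom_mul_apply, mul_inv_cancel, hom_one_apply]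

theorem norm_cocycle (x : P) (g : G) : ‖β.cocycle x g‖ = dist (β.hom g x) x :=
  (dist_eq_norm_vsub V _ _).symm

theorem norm_cocycle_mul_le (x : P) (g h : G) :
    ‖β.cocycle x (g * h)‖ ≤ ‖β.cocycle x g‖ + ‖β.cocycle x h‖ := by
  simp only [norm_cocycle, hom_mul_apply]
  rw [add_comm, ← (β.hom g).dist_map (β.hom h x)]
  exact dist_triangle _ _ _

theorem continuous_norm_cocycle (x : P) : Continuous fun g => ‖β.cocycle x g‖ := by
  simp only [norm_cocycle]
  exact (β.continuous_orbit x).dist continuous_const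

theorem measurable_norm_cocycle [MeasurableSpace G] [OpensMeasurableSpace G] (x : P) :
    Measurable fun g => ‖β.cocycle x g‖ :=
  (β.continuous_norm_cocycle x).measurable

end AffineIsometricAction

namespace IsGaussianKernel

variable {G V P H : Type*} [Group G] [TopologicalSpace G] [NormedAddCommGroup V]
  [InnerProductSpace ℝ V] [MetricSpace P] [NormedAddTorsor V P] {β : AffineIsometricAction G P}
  [NormedAddCommGroup H] [InnerProductSpace ℝ H] {ξ : P → H} {U : G → H →L[ℝ] H}

theorem norm_eq_one (hξ : IsGaussianKernel ξ) (a : P) : ‖ξ a‖ = 1 := by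
  have := hξ.inner a a
  rw [real_inner_self_eq_norm_sq, dist_self] at this
  rw [← sq_eq_sq₀ (norm_nonneg _) zero_le_one, this]
  simp

omit [Group G] in
-- `K` is linear in `η` and bounded uniformly in `g`, so each `K η` is a uniform limit of functions
-- coming from the span.
theorem continuous_of_range {K : H → G → ℝ} (hξ : IsGaussianKernel ξ)
    (hK : ∀ η η' g, K (η + η') g = K η g + K η' g) (hK' : ∀ (c : ℝ) η g, K (c • η) g = c * K η g)
    {C : ℝ} (hC : ∀ η g, |K η g| ≤ C * ‖η‖) (h : ∀ a, Continuous (K (ξ a))) (η : H) :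
    Continuous (K η) := by
  have hspan : ∀ η ∈ Submodule.span ℝ (Set.range ξ), Continuous (K η) := fun η hη => by
    induction hη using Submodule.span_induction with
    | mem x hx =>
      obtain ⟨a, rfl⟩ := hx
      exact h a
    | zero =>
      have : K 0 = fun _ => 0 := funext fun g => by simpa using hK' 0 0 g
      rw [this]
      exact continuous_const
    | add x y _ _ hx hy => rw [funext (hK x y)]; exact hx.add hy
    | smul c x _ hx => rw [funext (hK' c x)]; exact hx.const_mul c
  refine continuous_of_uniform_approx_of_continuous fun u hu => ?_
  obtain ⟨ε, hε, hεu⟩ := Metric.mem_uniformity_dist.1 hu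
  have hC1 : 0 < |C| + 1 := by positivity
  obtain ⟨η', hη', hd⟩ := Metric.dense_iff.1 hξ.dense η (ε / (|C| + 1)) (by positivity)
  refine ⟨K η', hspan η' hd, fun g => hεu ?_⟩
  have e : K η g - K η' g = K (η - η') g := by
    rw [sub_eq_add_neg η, hK, ← neg_one_smul ℝ η', hK']
    ring
  rw [Real.dist_eq, e]
  rw [Metric.mem_ball, dist_comm, dist_eq_norm, lt_div_iff₀ hC1] at hη'
  calc |K (η - η') g| ≤ C * ‖η - η'‖ := hC _ _
    _ ≤ ‖η - η'‖ * (|C| + 1) := by nlinarith [le_abs_self C, norm_nonneg (η - η')]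
    _ < ε := hη'

/-- Each axiom need only be tested on the total vectors `ξ a`, where it becomes a property of `β`:
adjointness is invariance of the distance, and weak continuity is continuity of orbits. -/
theorem isOrthogonalRep (hξ : IsGaussianKernel ξ) (hU : ∀ g a, U g (ξ a) = ξ (β.hom g a)) :
    IsOrthogonalRep U := by
  have one : ∀ η, U 1 η = η := fun η => by
    have : U 1 = ContinuousLinearMap.id ℝ H := ContinuousLinearMap.ext_on hξ.dense (by
      rintro _ ⟨a, rfl⟩
      rw [hU, β.hom_one_apply]
      rfl)
    rw [this]
    rfl
  have mul : ∀ g h η, U (g * h) η = U g (U h η) := fun g h η => by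
    have : U (g * h) = (U g).comp (U h) := ContinuousLinearMap.ext_on hξ.dense (by
      rintro _ ⟨a, rfl⟩
      rw [ContinuousLinearMap.comp_apply, hU, hU, hU, β.hom_mul_apply])
    rw [this]
    rfl
  have adj₁ : ∀ g η b, ⟪U g η, ξ b⟫ = ⟪η, U g⁻¹ (ξ b)⟫ := fun g η b => by
    have : (innerSL ℝ (ξ b)).comp (U g) = innerSL ℝ (U g⁻¹ (ξ b)) :=
      ContinuousLinearMap.ext_on hξ.dense (by
        rintro _ ⟨a, rfl⟩
        rw [ContinuousLinearMap.comp_apply, innerSL_apply_apply, innerSL_apply_apply, hU, hU,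
          hξ.inner, hξ.inner, dist_comm, β.dist_hom, dist_comm])
    have := DFunLike.congr_fun this η
    simp only [ContinuousLinearMap.comp_apply, innerSL_apply_apply] at this
    rw [real_inner_comm, this, real_inner_comm]
  have adj : ∀ g η η', ⟪U g η, η'⟫ = ⟪η, U g⁻¹ η'⟫ := fun g η η' => by
    have : innerSL ℝ (U g η) = (innerSL ℝ η).comp (U g⁻¹) :=
      ContinuousLinearMap.ext_on hξ.dense (by
        rintro _ ⟨b, rfl⟩
        exact adj₁ g η b)
    exact DFunLike.congr_fun this η'
  have hnorm : ∀ g η, ‖U g η‖ = ‖η‖ := fun g η => by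
    rw [← sq_eq_sq₀ (norm_nonneg _) (norm_nonneg _), ← real_inner_self_eq_norm_sq, adj,
      ← mul, inv_mul_cancel, one, real_inner_self_eq_norm_sq]
  have hbound : ∀ g η η', |⟪U g η, η'⟫| ≤ ‖η‖ * ‖η'‖ := fun g η η' => by
    rw [← hnorm g η]
    exact abs_real_inner_le_norm _ _
  have cont₁ : ∀ η b, Continuous fun g => ⟪U g η, ξ b⟫ := fun η b => by
    refine hξ.continuous_of_range (K := fun η g => ⟪U g η, ξ b⟫)
      (fun _ _ _ => by rw [map_add, inner_add_left])
      (fun _ _ _ => by rw [map_smul, real_inner_smul_left])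
      (C := ‖ξ b‖) (fun η g => by rw [mul_comm]; exact hbound _ _ _) (fun a => ?_) η
    simp only [hU, hξ.inner]
    have := (β.continuous_orbit a).dist (continuous_const (y := b))
    fun_prop
  refine ⟨one, mul, adj, fun η η' => ?_⟩
  exact hξ.continuous_of_range (K := fun η' g => ⟪U g η, η'⟫)
    (fun _ _ _ => by rw [inner_add_right]) (fun _ _ _ => by rw [real_inner_smul_right])
    (C := ‖η‖) (fun η' g => hbound _ _ _) (cont₁ η) η'

/-- For `η = ξ a` and `η' = ξ b` the coefficient is `exp (-d(g a, b)² / 8)`. Moving `a` and `b` to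
`x` changes the distance by at most a constant, which `exists_mul_add_sq_le` absorbs at the price of
`c`. -/
theorem exists_inner_le (hξ : IsGaussianKernel ξ) (hU : ∀ g a, U g (ξ a) = ξ (β.hom g a)) (x : P)
    {c : ℝ} (hc0 : 0 ≤ c) (hc : c < 1) {η : H} (hη : η ∈ Submodule.span ℝ (Set.range ξ)) :
    ∃ C, 0 < C ∧ ∀ g, ⟪U g η, η⟫ ≤ C * Real.exp (-(c * (1 / 8)) * ‖β.cocycle x g‖ ^ 2) := by
  -- Bilinear induction needs two separate vectors and an absolute value, the latter to survive
  -- scalars of either sign.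
  suffices h : ∀ η ∈ Submodule.span ℝ (Set.range ξ), ∀ η' ∈ Submodule.span ℝ (Set.range ξ),
      ∃ C, 0 ≤ C ∧ ∀ g, |⟪U g η, η'⟫| ≤ C * Real.exp (-(c * (1 / 8)) * ‖β.cocycle x g‖ ^ 2) by
    obtain ⟨C, hC, h⟩ := h η hη η hη
    refine ⟨C + 1, by positivity, fun g => (le_abs_self _).trans ((h g).trans ?_)⟩
    gcongr
    linarith
  intro η hη η' hη'
  induction hη, hη' using Submodule.span_induction₂ with
  | mem_mem u v hu hv =>
    obtain ⟨a, rfl⟩ := hu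
    obtain ⟨b, rfl⟩ := hv
    obtain ⟨C, hC, hCx⟩ := exists_mul_add_sq_le hc hc0
    refine ⟨Real.exp (C * (dist x a + dist x b) ^ 2 / 8), (Real.exp_pos _).le, fun g => ?_⟩
    rw [hU, hξ.inner, abs_of_pos (Real.exp_pos _), ← Real.exp_add, Real.exp_le_exp, β.norm_cocycle]
    have h1 : dist (β.hom g x) x ≤ dist (β.hom g a) b + (dist x a + dist x b) := by
      have h2 := dist_triangle4 (β.hom g x) (β.hom g a) b x
      rw [(β.hom g).dist_map, dist_comm b] at h2
      linarith
    have h3 := hCx (dist (β.hom g a) b) (dist x a + dist x b)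
    have h4 : dist (β.hom g x) x ^ 2 ≤ (dist (β.hom g a) b + (dist x a + dist x b)) ^ 2 := by
      gcongr
    nlinarith [mul_le_mul_of_nonneg_left h4 hc0]
  | zero_left v _ => exact ⟨0, le_rfl, fun g => by simp⟩
  | zero_right u _ => exact ⟨0, le_rfl, fun g => by simp⟩
  | add_left u v z _ _ _ h1 h2 =>
    obtain ⟨C, hC, h1⟩ := h1
    obtain ⟨C', hC', h2⟩ := h2
    refine ⟨C + C', by positivity, fun g => ?_⟩
    rw [map_add, inner_add_left, add_mul]
    exact (abs_add_le _ _).trans (add_le_add (h1 g) (h2 g))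
  | add_right u v z _ _ _ h1 h2 =>
    obtain ⟨C, hC, h1⟩ := h1
    obtain ⟨C', hC', h2⟩ := h2
    refine ⟨C + C', by positivity, fun g => ?_⟩
    rw [inner_add_right, add_mul]
    exact (abs_add_le _ _).trans (add_le_add (h1 g) (h2 g))
  | smul_left r u v _ _ h1 =>
    obtain ⟨C, hC, h1⟩ := h1
    refine ⟨|r| * C, by positivity, fun g => ?_⟩
    rw [map_smul, real_inner_smul_left, abs_mul, mul_assoc]
    gcongr
    exact h1 g
  | smul_right r u v _ _ h1 =>
    obtain ⟨C, hC, h1⟩ := h1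
    refine ⟨|r| * C, by positivity, fun g => ?_⟩
    rw [real_inner_smul_right, abs_mul, mul_assoc]
    gcongr
    exact h1 g

/-- The spectral radius is the exponential growth rate of the Gaussian functionals of the cocycle
along the random walk. -/
theorem exists_hasSpectralRadius [IsTopologicalGroup G] [SecondCountableTopology G]
    [MeasurableSpace G] [BorelSpace G] [CompleteSpace H] (hξ : IsGaussianKernel ξ)
    (hU : ∀ g a, U g (ξ a) = ξ (β.hom g a)) (μ : Measure G) [IsProbabilityMeasure μ]
    (hμ : μ.map (fun g => g⁻¹) = μ) :
    ∃ r, HasSpectralRadius U μ r ∧ r ≤ 1 ∧ ∀ x : P,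
      (∀ n, walkLaplace μ (fun g => ‖β.cocycle x g‖) n (1 / 8) ≤ r ^ n) ∧
      Tendsto (fun n : ℕ => walkLaplace μ (fun g => ‖β.cocycle x g‖) n (1 / 8) ^ (1 / (n : ℝ)))
        atTop (𝓝 r) := by
  have hrep := hξ.isOrthogonalRep hU
  obtain ⟨T, hT, hT1⟩ := hrep.exists_isWeakIntegral μ
  refine ⟨‖T‖, ⟨T, hT, rfl⟩, hT1, fun x => ?_⟩
  have hle : ∀ n, walkLaplace μ (fun g => ‖β.cocycle x g‖) n (1 / 8) ≤ ‖T‖ ^ n := fun n => by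
    have h1 := hrep.inner_pow hT n (ξ x) (ξ x)
    rw [walkLaplace_eq (β.measurable_norm_cocycle x)]
    have h2 : ∀ g, Real.exp (-(1 / 8) * ‖β.cocycle x g‖ ^ 2) = ⟪U g (ξ x), ξ x⟫ := fun g => by
      rw [hU, hξ.inner, β.norm_cocycle]
      ring_nf
    simp only [h2]
    rw [← h1]
    calc ⟪(T ^ n) (ξ x), ξ x⟫ ≤ ‖(T ^ n) (ξ x)‖ * ‖ξ x‖ := real_inner_le_norm _ _
      _ ≤ ‖T ^ n‖ * ‖ξ x‖ * ‖ξ x‖ := by gcongr; exact (T ^ n).le_opNorm _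
      _ = ‖T ^ n‖ := by rw [hξ.norm_eq_one]; ring
      _ ≤ ‖T‖ ^ n := by
        -- The case `n = 0` is apart: on the zero space the identity has norm `0`, so only `‖1‖ ≤ 1`
        -- holds in general.
        rcases n with _ | n
        · exact ContinuousLinearMap.norm_id_le
        · exact norm_pow_le' T n.succ_pos
  refine ⟨hle, ?_⟩
  refine tendsto_walkLaplace_rpow (β.measurable_norm_cocycle x) (fun g => norm_nonneg _)
    (β.norm_cocycle_mul_le x) (by norm_num) hT1 hle fun c r hc hc1 hr hrT => ?_
  simp only [walkLaplace_eq (β.measurable_norm_cocycle x)]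
  exact hrep.exists_pow_le_integral hT hμ hξ.dense
    (fun n => integrable_exp_neg_mul_sq_comp (β.measurable_norm_cocycle x) _ (by positivity))
    (fun η hη => hξ.exists_inner_le hU x hc.le hc1 hη) hr hrT

end IsGaussianKernel

/-! ### Koopman representations of Gaussian actions -/

namespace IsIsonormal

variable {V X : Type*} [NormedAddCommGroup V] [InnerProductSpace ℝ V] [MeasurableSpace X]
  {W : V → X → ℝ} {p : Measure X}

theorem map_withDensity_comp {G : Type*} [Group G] [TopologicalSpace G]
    (A : NonsingularAction G X p) (g : G) {D : X → ℝ≥0∞} (hD : Measurable D) :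
    (p.map (A.act g)).withDensity (fun ω => D (A.act g⁻¹ ω)) = (p.withDensity D).map (A.act g) := by
  have hm := (A.quasi g).measurable
  have hm' := (A.quasi g⁻¹).measurable
  ext S hS
  rw [withDensity_apply _ hS, Measure.map_apply hm hS, withDensity_apply _ (hm hS),
    ← lintegral_indicator hS, lintegral_map (Measurable.indicator (by fun_prop) hS) hm,
    ← lintegral_indicator (hm hS)]
  refine lintegral_congr_ae ?_
  filter_upwards [A.mul_ae g⁻¹ g, A.one_ae] with ω h1 h2
  rw [inv_mul_cancel, h2] at h1
  simp only [Set.indicator, ← h1]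
  rfl

/-- The square of `π(g) h` is the density of the image under `g` of `h² p`. Hence both sides are
nonnegative square roots of the same density. -/
theorem koopman_halfVec [IsProbabilityMeasure p] (h : IsIsonormal W p) {G : Type*} [Group G]
    [TopologicalSpace G] (A : NonsingularAction G X p) (g : G) {u v : V}
    (huv : (shiftMeasure W p u).map (A.act g) = shiftMeasure W p v) :
    A.koopman g (h.halfVec u) = h.halfVec v := by
  have hDm := fun v => (h.measurable_cameronMartin v).ennreal_ofReal
  have : IsProbabilityMeasure (p.map (A.act g)) :=
    Measure.isProbabilityMeasure_map (A.quasi g).measurable.aemeasurable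
  have hm' := (A.quasi g⁻¹).measurable
  have h1 := map_withDensity_comp A g (hDm u)
  rw [← shiftMeasure, huv, shiftMeasure,
    ← Measure.withDensity_rnDeriv_eq (p.map (A.act g)) p (A.quasi g).absolutelyContinuous,
    ← withDensity_mul _ (Measure.measurable_rnDeriv _ _)
      (g := fun ω => ENNReal.ofReal (cameronMartin W u (A.act g⁻¹ ω))) ((hDm u).comp hm')] at h1
  have hv := h.isProbabilityMeasure_shiftMeasure v
  have hcomp : Measurable fun ω => ENNReal.ofReal (cameronMartin W u (A.act g⁻¹ ω)) :=
    (hDm u).comp hm'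
  have h2 := (withDensity_eq_iff
    ((Measure.measurable_rnDeriv _ _).mul hcomp).aemeasurable (hDm v).aemeasurable
    (by
      rw [← setLIntegral_univ, ← withDensity_apply _ MeasurableSet.univ, h1]
      exact (measure_lt_top (shiftMeasure W p v) _).ne)).1 h1
  change (A.memLp_koopmanFun g (Lp.memLp (h.halfVec u))).toLp _ = _
  refine MemLp.toLp_congr _ _ ((A.koopmanFun_congr g (h.memLp_halfDensity u).coeFn_toLp).trans ?_)
  filter_upwards [h2] with ω hω
  simp only [Pi.mul_apply] at hω
  rw [NonsingularAction.koopmanFun, halfDensity_eq_sqrt, halfDensity_eq_sqrt,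
    ← Real.sqrt_mul ENNReal.toReal_nonneg]
  congr 1
  have := congrArg ENNReal.toReal hω
  rwa [ENNReal.toReal_mul, ENNReal.toReal_ofReal (Real.exp_pos _).le (r := cameronMartin W u _),
    ENNReal.toReal_ofReal (Real.exp_pos _).le (r := cameronMartin W v _)] at this

theorem isGaussianKernel (h : IsIsonormal W p) {P : Type*} [MetricSpace P] [NormedAddTorsor V P]
    (y : P) : IsGaussianKernel fun a : P => h.halfVec (a -ᵥ y) where
  inner a b := by
    rw [h.inner_halfVec, vsub_sub_vsub_cancel_right, dist_eq_norm_vsub V]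
  dense := by
    have : Set.range (fun a : P => h.halfVec (a -ᵥ y)) = Set.range h.halfVec := by
      ext F
      refine ⟨fun ⟨a, ha⟩ => ⟨_, ha⟩, fun ⟨v, hv⟩ => ⟨v +ᵥ y, ?_⟩⟩
      simpa using hv
    rw [this, Submodule.dense_iff_topologicalClosure_eq_top]
    exact h.span_halfVec

end IsIsonormal

/-! ### Gaussian densities as isonormal processes -/

section AffineInner

variable {V P : Type*} [NormedAddCommGroup V] [InnerProductSpace ℝ V] [MetricSpace P]
  [NormedAddTorsor V P]

/-- The affine function `x ↦ ⟪v, x - y⟫`. -/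
noncomputable def affineInner (y : P) (v : V) : P →ᴬ[ℝ] ℝ where
  toFun x := ⟪v, x -ᵥ y⟫
  linear := innerₗ V v
  map_vadd' x w := by
    simp [vadd_vsub_assoc, inner_add_right]
  cont := by fun_prop

theorem affineInner_apply (y : P) (v : V) (x : P) : affineInner y v x = ⟪v, x -ᵥ y⟫ := rfl

theorem contLinear_affineInner (y : P) (v : V) :
    (affineInner y v).contLinear = innerSL ℝ v := rfl

theorem affineInner_add (y : P) (u v : V) :
    affineInner y (u + v) = affineInner y u + affineInner y v := by
  ext x
  simp [affineInner_apply, inner_add_left]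

theorem affineInner_smul (y : P) (c : ℝ) (v : V) :
    affineInner y (c • v) = c • affineInner y v := by
  ext x
  simp [affineInner_apply, inner_smul_left]

theorem eq_const_add_affineInner [CompleteSpace V] (f : P →ᴬ[ℝ] ℝ) (y : P) :
    f = ContinuousAffineMap.const ℝ P (f y)
      + affineInner y ((InnerProductSpace.toDual ℝ V).symm f.contLinear) := by
  ext x
  rw [ContinuousAffineMap.add_apply, affineInner_apply, InnerProductSpace.toDual_symm_apply,
    ContinuousAffineMap.contLinear_map_vsub]
  simp

end AffineInner

/-- With `y` as origin, the variables of affine functions vanishing at `y` form an isonormal process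
under `m y`. The law of each `W u` under `m a` is then that under the Cameron-Martin shift by `a -
y`, and these laws determine the measure. -/
theorem IsGaussianDensity.exists_isIsonormal {V P X : Type*} [NormedAddCommGroup V]
    [InnerProductSpace ℝ V] [CompleteSpace V] [MetricSpace P] [NormedAddTorsor V P]
    [MeasurableSpace X] {m : P → Measure X} (hm : IsGaussianDensity m) (y : P) :
    ∃ W : V → X → ℝ, IsIsonormal W (m y) ∧ ∀ a, m a = shiftMeasure W (m y) (a -ᵥ y) := by
  obtain ⟨hat, hmeas, hadd, hsmul, hlaw, hgen⟩ := hm.exists_hat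
  have hconst : ∀ c, hat (ContinuousAffineMap.const ℝ P c) =ᵐ[m y] fun _ => c := fun c => by
    have h1 := hlaw (ContinuousAffineMap.const ℝ P c) y
    rw [ContinuousAffineMap.const_contLinear, nnnorm_zero, zero_pow two_ne_zero,
      gaussianReal_zero_var, ContinuousAffineMap.coe_const, Function.const_apply] at h1
    have h2 : ∀ᵐ z ∂((m y).map (hat (ContinuousAffineMap.const ℝ P c))), z = c := by
      rw [h1, ae_dirac_eq]
      rfl
    exact ae_of_ae_map (hmeas _).aemeasurable h2
  have hW : IsIsonormal (fun v => hat (affineInner y v)) (m y) :=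
    { measurable := fun v => hmeas _
      add_ae := fun u v => by rw [affineInner_add]; exact hadd _ _ _
      smul_ae := fun c v => by rw [affineInner_smul]; exact hsmul _ _ _
      law := fun v => by
        rw [hlaw, affineInner_apply, vsub_self, inner_zero_right, contLinear_affineInner]
        congr 2
        exact NNReal.eq (innerSL_apply_norm ℝ v)
      generates := fun S hS => by
        obtain ⟨S', hS', hSS⟩ := hgen S hS
        -- Discarding constants loses nothing modulo null sets: the variable of a constant function
        -- has zero variance, so `hat f` is almost surely `f y` plus the variable of the linear
        -- part.
        have hle : (⨆ f, MeasurableSpace.comap (hat f) inferInstance)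
            ≤ eventuallyMeasurableSpace
              (⨆ v, MeasurableSpace.comap (hat (affineInner y v)) inferInstance) (ae (m y)) := by
          refine iSup_le fun f => ?_
          rintro _ ⟨B, hB, rfl⟩
          set v := (InnerProductSpace.toDual ℝ V).symm f.contLinear
          refine ⟨(fun ω => f y + hat (affineInner y v) ω) ⁻¹' B, ?_, ?_⟩
          · refine (le_iSup (fun v => MeasurableSpace.comap (hat (affineInner y v)) inferInstance) v)
              _ ⟨(fun z => f y + z) ⁻¹' B, measurable_const_add _ hB, rfl⟩
          · have h1 : hat f =ᵐ[m y] fun ω => f y + hat (affineInner y v) ω := by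
              have h2 := hadd (ContinuousAffineMap.const ℝ P (f y)) (affineInner y v) y
              rw [← eq_const_add_affineInner] at h2
              filter_upwards [h2, hconst (f y)] with ω h3 h4
              rw [h3, Pi.add_apply, h4]
            exact h1.preimage B
        obtain ⟨S'', hS'', h⟩ := hle _ hS'
        exact ⟨S'', hS'', (hSS y).trans h⟩ }
  refine ⟨_, hW, fun a => ?_⟩
  have := hm.prob a
  refine hW.eq_shiftMeasure (hm.equiv a y) _ fun u => ?_
  rw [hlaw, affineInner_apply, contLinear_affineInner]
  congr 2
  exact NNReal.eq (innerSL_apply_norm ℝ u)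

/-- The spectral radius of any realization of the Gaussian action of `β`. -/
theorem IsGaussianAction.exists_hasSpectralRadius {G V P X : Type*} [Group G] [TopologicalSpace G]
    [IsTopologicalGroup G] [SecondCountableTopology G] [MeasurableSpace G] [BorelSpace G]
    [NormedAddCommGroup V] [InnerProductSpace ℝ V] [CompleteSpace V] [MetricSpace P]
    [NormedAddTorsor V P] [MeasurableSpace X] {β : AffineIsometricAction G P} {m : P → Measure X}
    {y : P} [IsProbabilityMeasure (m y)] {A : NonsingularAction G X (m y)}
    (hA : IsGaussianAction β m A) (hm : IsGaussianDensity m) (μ : Measure G)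
    [IsProbabilityMeasure μ] (hμ : μ.map (fun g => g⁻¹) = μ) :
    ∃ r, HasSpectralRadius A.koopman μ r ∧ r ≤ 1 ∧ ∀ x : P,
      (∀ n, walkLaplace μ (fun g => ‖β.cocycle x g‖) n (1 / 8) ≤ r ^ n) ∧
      Tendsto (fun n : ℕ => walkLaplace μ (fun g => ‖β.cocycle x g‖) n (1 / 8) ^ (1 / (n : ℝ)))
        atTop (𝓝 r) := by
  obtain ⟨W, hW, hmW⟩ := hm.exists_isIsonormal y
  refine (hW.isGaussianKernel y).exists_hasSpectralRadius (fun g a => ?_) μ hμ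
  refine hW.koopman_halfVec A g ?_
  rw [← hmW, ← hmW]
  exact hA g a

/-! ### Existence of isonormal processes -/

/-- Distinct orthonormal vectors are at distance `√2 > 1`, so the balls of radius `1 / 2` around
them are disjoint. -/
theorem Orthonormal.countable {ι V : Type*} [NormedAddCommGroup V] [InnerProductSpace ℝ V]
    [TopologicalSpace.SeparableSpace V] {e : ι → V} (he : Orthonormal ℝ e) : Countable ι := by
  refine Pairwise.countable_of_isOpen_disjoint (s := fun i => Metric.ball (e i) (1 / 2))
    (fun i j hij => ?_) (fun i => Metric.isOpen_ball) fun i => ⟨e i, by simp⟩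
  refine Metric.ball_disjoint_ball ?_
  have h1 : dist (e i) (e j) ^ 2 = 2 := by
    rw [dist_eq_norm, norm_sub_sq_real, he.1, he.1, he.2 hij]
    norm_num
  nlinarith [dist_nonneg (x := e i) (y := e j)]

/-- Indexing by a subset of `ℕ` places the model space `I → ℝ` in `Type`, whatever the universe of
`V`, and makes it standard Borel. -/
theorem exists_hilbertBasis_nat (V : Type*) [NormedAddCommGroup V] [InnerProductSpace ℝ V]
    [CompleteSpace V] [TopologicalSpace.SeparableSpace V] :
    ∃ I : Set ℕ, Nonempty (HilbertBasis I ℝ V) := by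
  obtain ⟨w, b, -⟩ := exists_hilbertBasis ℝ V
  have := b.orthonormal.countable
  obtain ⟨f, hf⟩ := exists_injective_nat w
  let E := Equiv.ofInjective f hf
  refine ⟨Set.range f, ⟨HilbertBasis.mk (v := b ∘ E.symm)
    (b.orthonormal.comp _ E.symm.injective) ?_⟩⟩
  rw [E.symm.surjective.range_comp, b.dense_span]

theorem sq_integral_gaussianReal (v : ℝ≥0) : ∫ x, x ^ 2 ∂(gaussianReal 0 v) = v := by
  have h := variance_fun_id_gaussianReal (μ := 0) (v := v)
  rw [variance_eq_integral (by fun_prop)] at h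
  simpa [integral_id_gaussianReal] using h

theorem eLpNorm_two_of_map_eq_gaussianReal {X : Type*} [MeasurableSpace X] {p : Measure X}
    {Y : X → ℝ} (hY : Measurable Y) {r : ℝ≥0} (h : p.map Y = gaussianReal 0 (r ^ 2)) :
    eLpNorm Y 2 p = r := by
  have h1 : eLpNorm Y 2 p = eLpNorm id 2 (gaussianReal 0 (r ^ 2)) := by
    rw [← h, eLpNorm_map_measure (by fun_prop) hY.aemeasurable]
    rfl
  have hm : MemLp id 2 (gaussianReal 0 (r ^ 2)) := memLp_id_gaussianReal 2
  rw [h1, hm.eLpNorm_eq_integral_rpow_norm (by norm_num) (by norm_num)]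
  simp only [ENNReal.toReal_ofNat, Real.rpow_two, id, Real.norm_eq_abs, sq_abs,
    sq_integral_gaussianReal]
  rw [NNReal.coe_pow, ← one_div, ← Real.sqrt_eq_rpow, Real.sqrt_sq r.coe_nonneg, ENNReal.ofReal_coe_nnreal]

section Coordinates

variable {I : Type*}

theorem map_coordinate (i : I) :
    (Measure.infinitePi fun _ : I => gaussianReal 0 1).map (fun ω => ω i) = gaussianReal 0 1 :=
  Measure.infinitePi_map_eval (fun _ : I => gaussianReal 0 1) i

theorem memLp_coordinate (i : I) :
    MemLp (fun ω : I → ℝ => ω i) 2 (Measure.infinitePi fun _ : I => gaussianReal 0 1) := by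
  have hm : MemLp id 2 (gaussianReal 0 1) := memLp_id_gaussianReal 2
  rw [← map_coordinate i] at hm
  exact (memLp_map_measure_iff hm.1 (measurable_pi_apply i).aemeasurable).1 hm

theorem iIndepFun_coordinate : iIndepFun (fun (i : I) (ω : I → ℝ) => ω i)
    (Measure.infinitePi fun _ : I => gaussianReal 0 1) :=
  iIndepFun_infinitePi (X := fun _ x => x) (fun _ => measurable_id)

theorem orthonormal_coordinate : Orthonormal ℝ fun i : I => (memLp_coordinate i).toLp _ := by
  classical
  rw [orthonormal_iff_ite]
  intro i j
  have h : (fun ω => ⟪(memLp_coordinate i).toLp _ ω, (memLp_coordinate j).toLp _ ω⟫)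
      =ᵐ[Measure.infinitePi fun _ : I => gaussianReal 0 1] fun ω => ω i * ω j := by
    filter_upwards [(memLp_coordinate i).coeFn_toLp, (memLp_coordinate j).coeFn_toLp] with ω h1 h2
    rw [h1, h2, real_inner_eq_re_inner, RCLike.inner_apply', conj_trivial, RCLike.re_to_real]
  rw [L2.inner_def, integral_congr_ae h]
  split_ifs with hij
  · subst hij
    have := sq_integral_gaussianReal 1
    rw [← map_coordinate i, integral_map (measurable_pi_apply i).aemeasurable (by fun_prop)] at this
    simpa [sq] using this
  · have h0 : ∀ i : I, ∫ ω : I → ℝ, ω i ∂(Measure.infinitePi fun _ : I => gaussianReal 0 1) = 0 :=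
      fun i => by
      have := integral_id_gaussianReal (μ := 0) (v := 1)
      rwa [← map_coordinate i, integral_map (measurable_pi_apply i).aemeasurable (by fun_prop)]
        at this
    rw [(iIndepFun_coordinate.indepFun hij).integral_fun_mul_eq_mul_integral
      (measurable_pi_apply i).aestronglyMeasurable (measurable_pi_apply j).aestronglyMeasurable, h0, zero_mul]

theorem map_sum_coordinate (s : Finset I) (c : I → ℝ) :
    (Measure.infinitePi fun _ : I => gaussianReal 0 1).map (fun ω => ∑ i ∈ s, c i * ω i)
      = gaussianReal 0 (∑ i ∈ s, ‖c i‖₊ ^ 2) := by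
  have hind : iIndepFun (fun (i : I) (ω : I → ℝ) => c i * ω i)
      (Measure.infinitePi fun _ : I => gaussianReal 0 1) :=
    iIndepFun_infinitePi (X := fun i x => c i * x) (fun _ => by fun_prop)
  have hmeas : ∀ i, Measurable fun ω : I → ℝ => c i * ω i := fun i => by fun_prop
  have hlaw : ∀ i, (Measure.infinitePi fun _ : I => gaussianReal 0 1).map (fun ω => c i * ω i)
      = gaussianReal 0 (‖c i‖₊ ^ 2) := fun i => by
    rw [← Function.comp_def (fun x => c i * x) (fun ω : I → ℝ => ω i),
      ← Measure.map_map (by fun_prop) (by fun_prop), map_coordinate, gaussianReal_map_const_mul,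
      mul_zero, mul_one]
    congr 1
    ext
    simp
  have hint : ∀ i (t : ℝ), Integrable (fun ω : I → ℝ => Real.exp (t * (c i * ω i)))
      (Measure.infinitePi fun _ : I => gaussianReal 0 1) := fun i t => by
    have := integrable_exp_mul_gaussianReal (μ := 0) (v := ‖c i‖₊ ^ 2) t
    rw [← hlaw i] at this
    exact (integrable_map_measure (by fun_prop) (hmeas i).aemeasurable).1 this
  conv_rhs => rw [← Measure.map_id (μ := gaussianReal 0 (∑ i ∈ s, ‖c i‖₊ ^ 2))]
  have e : (fun ω : I → ℝ => ∑ i ∈ s, c i * ω i) = ∑ i ∈ s, fun ω : I → ℝ => c i * ω i := by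
    ext ω
    simp
  refine map_eq_of_mgf_eq (Finset.measurable_fun_sum _ fun i _ => hmeas i).aemeasurable
    aemeasurable_id (fun t => ?_) (funext fun t => ?_)
  · have := hind.integrable_exp_mul_sum (t := t) (s := s) hmeas (fun i _ => hint i t)
    simpa using this
  · rw [e, hind.mgf_sum hmeas, mgf_id_gaussianReal]
    simp only [mgf_gaussianReal (hlaw _), ← Real.exp_sum]
    push_cast
    rw [zero_mul, zero_add, Finset.sum_mul, Finset.sum_div]
    simp

end Coordinates

/-- The characteristic function at `t` is `|t|`-Lipschitz in the `L¹` norm, hence in `L²`. This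
carries Gaussian laws from finite combinations to their closure. -/
theorem continuous_charFun_map {X : Type*} [MeasurableSpace X] {p : Measure X}
    [IsProbabilityMeasure p] (t : ℝ) :
    Continuous fun F : Lp ℝ 2 p => charFun (p.map F) t := by
  refine LipschitzWith.continuous (K := ‖t‖₊) (LipschitzWith.of_dist_le_mul fun F F' => ?_)
  have hm := (Lp.stronglyMeasurable F).measurable
  have hm' := (Lp.stronglyMeasurable F').measurable
  have hi : ∀ H : X → ℝ, Measurable H → Integrable (fun x => Complex.exp (t * H x * Complex.I)) p :=
    fun H hH => Integrable.of_bound (by fun_prop) 1 (Eventually.of_forall fun x => by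
      rw [← Complex.ofReal_mul, Complex.norm_exp_ofReal_mul_I])
  rw [charFun_apply_real, charFun_apply_real, integral_map hm.aemeasurable (by fun_prop),
    integral_map hm'.aemeasurable (by fun_prop), dist_eq_norm, ← integral_sub (hi _ hm) (hi _ hm')]
  have hb : ∀ x, ‖Complex.exp (t * F x * Complex.I) - Complex.exp (t * F' x * Complex.I)‖
      ≤ |t| * |F x - F' x| := fun x => by
    have e : Complex.exp (t * F x * Complex.I) - Complex.exp (t * F' x * Complex.I)
        = Complex.exp ((t * F' x : ℝ) * Complex.I)
          * (Complex.exp (Complex.I * (t * (F x - F' x) : ℝ)) - 1) := by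
      rw [mul_sub, ← Complex.exp_add, mul_one]
      push_cast
      ring_nf
    rw [e, norm_mul, Complex.norm_exp_ofReal_mul_I, one_mul, ← abs_mul]
    exact Real.norm_exp_I_mul_ofReal_sub_one_le
  have hint : Integrable (F - F' : Lp ℝ 2 p) p := (Lp.memLp _).integrable (by norm_num)
  have hae : (fun x => |F x - F' x|) =ᵐ[p] fun x => ‖(F - F' : Lp ℝ 2 p) x‖ := by
    filter_upwards [Lp.coeFn_sub F F'] with x hx
    rw [hx]
    rfl
  calc ‖∫ x, (Complex.exp (t * F x * Complex.I) - Complex.exp (t * F' x * Complex.I)) ∂p‖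
      ≤ ∫ x, |t| * |F x - F' x| ∂p := by
        refine norm_integral_le_of_norm_le ?_ (Eventually.of_forall hb)
        exact ((hint.norm.congr hae.symm).const_mul _)
    _ = |t| * ∫ x, ‖(F - F' : Lp ℝ 2 p) x‖ ∂p := by
        rw [integral_const_mul, integral_congr_ae hae]
    _ ≤ |t| * ‖F - F'‖ := by
        gcongr
        rw [Lp.norm_def, integral_norm_eq_lintegral_enorm (Lp.aestronglyMeasurable _),
          ← eLpNorm_one_eq_lintegral_enorm]
        exact ENNReal.toReal_mono (Lp.eLpNorm_ne_top _)
          (eLpNorm_le_eLpNorm_of_exponent_le (by norm_num) (Lp.aestronglyMeasurable _))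
    _ = _ := by
        rw [dist_eq_norm]
        rfl

/-- A Hilbert basis is sent to the coordinates of a product of standard Gaussians and extended to an
isometry `V → L²`. The last two clauses let a map of the sample space be prescribed by its
coordinates. -/
theorem exists_isIsonormal (V : Type*) [NormedAddCommGroup V] [InnerProductSpace ℝ V]
    [CompleteSpace V] [TopologicalSpace.SeparableSpace V] :
    ∃ (I : Set ℕ) (e : I → V) (p : Measure (I → ℝ)) (W : V → (I → ℝ) → ℝ), IsIsonormal W p ∧
      Dense (Submodule.span ℝ (Set.range e) : Set V) ∧ ∀ i, W (e i) =ᵐ[p] fun ω => ω i := by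
  classical
  obtain ⟨I, ⟨b⟩⟩ := exists_hilbertBasis_nat V
  set p : Measure (I → ℝ) := Measure.infinitePi fun _ : I => gaussianReal 0 1 with hp
  let J : V →ₗᵢ[ℝ] Lp ℝ 2 p :=
    (orthonormal_coordinate (I := I)).orthogonalFamily.linearIsometry.comp
      b.repr.toLinearIsometry
  have hJ : ∀ i, J (b i) = (memLp_coordinate i).toLp _ := fun i => by
    change (orthonormal_coordinate (I := I)).orthogonalFamily.linearIsometry (b.repr (b i)) = _
    rw [b.repr_self, OrthogonalFamily.linearIsometry_apply_single]
    simp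
  have hJi : ∀ i, (J (b i) : (I → ℝ) → ℝ) =ᵐ[p] fun ω => ω i := fun i => by
    rw [hJ]
    exact (memLp_coordinate i).coeFn_toLp
  have hdense : Dense (Submodule.span ℝ (Set.range b) : Set V) :=
    Submodule.dense_iff_topologicalClosure_eq_top.2 b.dense_span
  have hmeas : ∀ v, Measurable (J v) := fun v => (Lp.stronglyMeasurable (J v)).measurable
  have hspan : ∀ v ∈ Submodule.span ℝ (Set.range b), p.map (J v) = gaussianReal 0 (‖v‖₊ ^ 2) := by
    intro v hv
    obtain ⟨c, rfl⟩ := (Finsupp.mem_span_range_iff_exists_finsupp).1 hv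
    have h1 : ∀ s : Finset I, (J (∑ i ∈ s, c i • b i) : (I → ℝ) → ℝ)
        =ᵐ[p] fun ω => ∑ i ∈ s, c i * ω i := fun s => by
      induction s using Finset.induction_on with
      | empty =>
        simp only [Finset.sum_empty, map_zero]
        exact Lp.coeFn_zero _ _ _
      | insert i s hi ih =>
        simp only [Finset.sum_insert hi, map_add, map_smul]
        filter_upwards [Lp.coeFn_add (c i • J (b i)) (J (∑ i ∈ s, c i • b i)),
          Lp.coeFn_smul (c i) (J (b i)), hJi i, ih] with ω h1 h2 h3 h4
        rw [h1, Pi.add_apply, h2, Pi.smul_apply, h3, h4, smul_eq_mul]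
    rw [Finsupp.sum, Measure.map_congr (h1 _), hp, map_sum_coordinate]
    congr 1
    refine NNReal.eq ?_
    push_cast
    rw [← real_inner_self_eq_norm_sq, b.orthonormal.inner_sum]
    simp [sq]
  have hlaw : ∀ v, p.map (J v) = gaussianReal 0 (‖v‖₊ ^ 2) := fun v => by
    refine Measure.ext_of_charFun (funext fun t => ?_)
    rw [charFun_gaussianReal]
    refine congrFun (Continuous.ext_on hdense ((continuous_charFun_map t).comp J.continuous)
      (g := fun v => Complex.exp (t * (0 : ℝ) * Complex.I - ((‖v‖₊ ^ 2 : ℝ≥0) : ℝ) * t ^ 2 / 2))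
      (by fun_prop) fun v hv => ?_) v
    simp only [Function.comp]
    rw [hspan v hv, charFun_gaussianReal]
  refine ⟨I, b, p, fun v => J v, ⟨hmeas, fun u v => ?_, fun c v => ?_, hlaw, fun S hS => ?_⟩,
    hdense, hJi⟩
  · simp only [map_add]
    exact Lp.coeFn_add _ _
  · simp only [map_smul]
    exact Lp.coeFn_smul _ _
  -- The joint map of the `J (b i)` is almost surely the identity, a countable intersection of
  -- full-measure events.
  · refine ⟨(fun ω i => J (b i) ω) ⁻¹' S, ?_, ?_⟩
    · refine (@measurable_pi_iff _ _ _ (_) _ _).2 (fun i => ?_) hS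
      exact (measurable_iff_comap_le.2
        (le_iSup (fun v => MeasurableSpace.comap (J v) inferInstance) (b i)))
    · have : (fun ω i => J (b i) ω) =ᵐ[p] id := by
        filter_upwards [ae_all_iff.2 hJi] with ω hω
        exact funext hω
      exact (this.preimage S).symm

/-! ### Point realizations of affine isometries -/

/-- The point realization of the affine isometry with linear part `L` and translation part `b`. -/
noncomputable def affineRealization {V I : Type*} [NormedAddCommGroup V] [InnerProductSpace ℝ V]
    (W : V → (I → ℝ) → ℝ) (e : I → V) (L : V ≃ₗᵢ[ℝ] V) (b : V) (ω : I → ℝ) (i : I) : ℝ :=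
  W (L.symm (e i)) ω + ⟪e i, b⟫

namespace IsIsonormal

theorem map_add_const {V X : Type*} [NormedAddCommGroup V] [InnerProductSpace ℝ V]
    [MeasurableSpace X] {W : V → X → ℝ} {p : Measure X} (h : IsIsonormal W p) (v : V) (c : ℝ)
    {q : Measure X} {a : ℝ} {σ : ℝ≥0} (hq : q.map (W v) = gaussianReal a σ) :
    q.map (fun ω => W v ω + c) = gaussianReal (a + c) σ := by
  rw [← Function.comp_def (fun x => x + c) (W v), ← Measure.map_map (by fun_prop) (h.measurable v),
    hq, gaussianReal_map_add_const]

variable {V I : Type*} [NormedAddCommGroup V] [InnerProductSpace ℝ V]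
  {W : V → (I → ℝ) → ℝ} {p : Measure (I → ℝ)} {e : I → V}

theorem measurable_affineRealization (h : IsIsonormal W p) (L : V ≃ₗᵢ[ℝ] V) (b : V) :
    Measurable (affineRealization W e L b) :=
  measurable_pi_lambda _ fun _ => (h.measurable _).add_const _

theorem sum_coordinate_ae (h : IsIsonormal W p) (he : ∀ i, W (e i) =ᵐ[p] fun ω => ω i)
    (s : Finset I) (c : I → ℝ) : (fun ω => ∑ i ∈ s, c i * ω i) =ᵐ[p] W (∑ i ∈ s, c i • e i) := by
  refine EventuallyEq.trans ?_ (h.sum_ae s c e)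
  have : ∀ᵐ ω ∂p, ∀ i ∈ s, W (e i) ω = ω i := (Finset.eventually_all s).2 fun i _ => he i
  filter_upwards [this] with ω hω
  exact Finset.sum_congr rfl fun i hi => by rw [hω i hi]

theorem sum_affineRealization_ae (h : IsIsonormal W p) (L : V ≃ₗᵢ[ℝ] V) (b : V)
    (s : Finset I) (c : I → ℝ) :
    (fun ω => ∑ i ∈ s, c i * affineRealization W e L b ω i) =ᵐ[p]
      fun ω => W (L.symm (∑ i ∈ s, c i • e i)) ω + ⟪∑ i ∈ s, c i • e i, b⟫ := by
  filter_upwards [h.sum_ae s c fun i => L.symm (e i)] with ω hω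
  simp only [affineRealization, mul_add, Finset.sum_add_distrib, map_sum, map_smul]
  rw [hω, sum_inner]
  simp [inner_smul_left]

theorem map_affineRealization (h : IsIsonormal W p) (he : ∀ i, W (e i) =ᵐ[p] fun ω => ω i)
    (L : V ≃ₗᵢ[ℝ] V) (b : V) : p.map (affineRealization W e L b) = shiftMeasure W p b := by
  have := h.isProbabilityMeasure
  have := h.isProbabilityMeasure_shiftMeasure b
  have hm := h.measurable_affineRealization (e := e) L b
  have key := map_pi_eq_of_map_sum_eq (μ := p.map (affineRealization W e L b))
    (ν := shiftMeasure W p b) (Y := fun i (ω : I → ℝ) => ω i) (fun i => measurable_pi_apply i)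
    fun s c => by
      have hs : Measurable fun ω : I → ℝ => ∑ i ∈ s, c i * ω i :=
        Finset.measurable_fun_sum _ fun _ _ => (measurable_pi_apply _).const_mul _
      rw [Measure.map_map hs hm, Measure.map_congr
        ((shiftMeasure_absolutelyContinuous W p b).ae_le (h.sum_coordinate_ae he s c)),
        h.map_shiftMeasure, Function.comp_def, Measure.map_congr (h.sum_affineRealization_ae L b s c),
        h.map_add_const _ _ (h.law _), zero_add, LinearIsometryEquiv.nnnorm_map]
  simpa using key

theorem affineRealization_absolutelyContinuous (h : IsIsonormal W p)
    (he : ∀ i, W (e i) =ᵐ[p] fun ω => ω i) (L : V ≃ₗᵢ[ℝ] V) (b : V) :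
    p.map (affineRealization W e L b) ≪ p := by
  rw [h.map_affineRealization he]
  exact shiftMeasure_absolutelyContinuous W p b

/-- On the span of the `e i` this is almost sure linearity. The defect `Z v` is additive in `v` and
bounded by `2 ‖v‖` in `L²`, so it vanishes on the closure. Absolute continuity of the image measure
allows almost sure identities to be composed with the realization. -/
theorem comp_affineRealization_ae (h : IsIsonormal W p) (he : ∀ i, W (e i) =ᵐ[p] fun ω => ω i)
    (hd : Dense (Submodule.span ℝ (Set.range e) : Set V)) (L : V ≃ₗᵢ[ℝ] V) (b v : V) :
    (fun ω => W v (affineRealization W e L b ω)) =ᵐ[p] fun ω => W (L.symm v) ω + ⟪v, b⟫ := by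
  have := h.isProbabilityMeasure
  have hm := h.measurable_affineRealization (e := e) L b
  have hac := h.affineRealization_absolutelyContinuous he L b
  have pull : ∀ {q : (I → ℝ) → Prop}, (∀ᵐ ω ∂p, q ω) → ∀ᵐ ω ∂p, q (affineRealization W e L b ω) :=
    fun hq => ae_of_ae_map hm.aemeasurable (hac.ae_le hq)
  set Z : V → (I → ℝ) → ℝ := fun v ω =>
    (W v (affineRealization W e L b ω) - ⟪v, b⟫) - W (L.symm v) ω with hZ
  have hZm : ∀ v, Measurable (Z v) := fun v =>
    (((h.measurable v).comp hm).sub_const _).sub (h.measurable _)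
  have hZadd : ∀ u v, Z (u + v) =ᵐ[p] Z u + Z v := fun u v => by
    filter_upwards [pull (h.add_ae u v), h.add_ae (L.symm u) (L.symm v)] with ω h1 h2
    simp only [hZ, Pi.add_apply, h1, map_add, h2, inner_add_left]
    ring
  have hZspan : ∀ v ∈ Submodule.span ℝ (Set.range e), Z v =ᵐ[p] 0 := fun v hv => by
    obtain ⟨c, rfl⟩ := (Finsupp.mem_span_range_iff_exists_finsupp).1 hv
    rw [Finsupp.sum]
    filter_upwards [pull (h.sum_coordinate_ae he c.support c),
      h.sum_affineRealization_ae (e := e) L b c.support c] with ω h1 h2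
    simp only [hZ, ← h1, h2, Pi.zero_apply]
    ring
  have hZnorm : ∀ v, eLpNorm (Z v) 2 p ≤ 2 * ‖v‖₊ := fun v => by
    have h1 : p.map (fun ω => W v (affineRealization W e L b ω) - ⟪v, b⟫)
        = gaussianReal 0 (‖v‖₊ ^ 2) := by
      have h2 := h.map_add_const v (-⟪v, b⟫) (h.map_shiftMeasure v b)
      rw [← h.map_affineRealization he L b, Measure.map_map ((h.measurable v).add_const _) hm,
        add_neg_cancel] at h2
      simpa only [Function.comp_def, ← sub_eq_add_neg] using h2
    have h3 := h.law (L.symm v)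
    rw [LinearIsometryEquiv.nnnorm_map] at h3
    have hm1 : Measurable fun ω => W v (affineRealization W e L b ω) - ⟪v, b⟫ :=
      ((h.measurable v).comp hm).sub_const _
    refine (eLpNorm_sub_le hm1.aestronglyMeasurable (h.measurable _).aestronglyMeasurable
      (by norm_num)).trans (le_of_eq ?_)
    rw [eLpNorm_two_of_map_eq_gaussianReal hm1 h1,
      eLpNorm_two_of_map_eq_gaussianReal (h.measurable _) h3, two_mul]
  have hZ0 : Z v =ᵐ[p] 0 := by
    rw [← eLpNorm_eq_zero_iff (hZm v).aestronglyMeasurable (by norm_num : (2 : ℝ≥0∞) ≠ 0)]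
    refine le_antisymm (ENNReal.le_of_forall_pos_le_add fun ε hε _ => ?_) zero_le
    obtain ⟨u, hu, hu'⟩ := Metric.dense_iff.1 hd v (ε / 2) (by positivity)
    have h1 : Z v =ᵐ[p] Z (v - u) := by
      have h2 := hZadd (v - u) u
      rw [sub_add_cancel] at h2
      filter_upwards [h2, hZspan u hu'] with ω h3 h4
      rw [h3, Pi.add_apply, h4, Pi.zero_apply, add_zero]
    rw [eLpNorm_congr_ae h1, zero_add]
    refine (hZnorm _).trans ?_
    rw [Metric.mem_ball, dist_comm, dist_eq_norm, lt_div_iff₀ two_pos] at hu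
    rw [mul_comm, ← ENNReal.coe_ofNat, ← ENNReal.coe_mul, ENNReal.coe_le_coe]
    exact_mod_cast hu.le
  filter_upwards [hZ0] with ω hω
  simp only [hZ, Pi.zero_apply] at hω
  linarith

theorem map_affineRealization_shiftMeasure (h : IsIsonormal W p)
    (he : ∀ i, W (e i) =ᵐ[p] fun ω => ω i)
    (hd : Dense (Submodule.span ℝ (Set.range e) : Set V)) (L : V ≃ₗᵢ[ℝ] V) (b u : V) :
    (shiftMeasure W p u).map (affineRealization W e L b) = shiftMeasure W p (L u + b) := by
  have := h.isProbabilityMeasure_shiftMeasure u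
  have hm := h.measurable_affineRealization (e := e) L b
  refine h.eq_shiftMeasure (((shiftMeasure_absolutelyContinuous W p u).map hm).trans
    (h.affineRealization_absolutelyContinuous he L b)) _ fun v => ?_
  rw [Measure.map_map (h.measurable v) hm, Function.comp_def, Measure.map_congr
    ((shiftMeasure_absolutelyContinuous W p u).ae_le (h.comp_affineRealization_ae he hd L b v)),
    h.map_add_const _ _ (h.map_shiftMeasure _ _), LinearIsometryEquiv.nnnorm_map, inner_add_right]
  congr 2
  rw [← L.inner_map_map, L.apply_symm_apply]

/-- The translation part is that of `x ↦ L (L' x + b') + b`. Countability of `I` gathers the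
coordinatewise null sets into one. -/
theorem affineRealization_comp_ae [Countable I] (h : IsIsonormal W p)
    (he : ∀ i, W (e i) =ᵐ[p] fun ω => ω i)
    (hd : Dense (Submodule.span ℝ (Set.range e) : Set V)) (L L' : V ≃ₗᵢ[ℝ] V) (b b' : V) :
    affineRealization W e (L'.trans L) (L b' + b) =ᵐ[p]
      fun ω => affineRealization W e L b (affineRealization W e L' b' ω) := by
  filter_upwards [ae_all_iff.2 fun i =>
    h.comp_affineRealization_ae he hd L' b' (L.symm (e i))] with ω hω
  funext i
  have h1 : ⟪L.symm (e i), b'⟫ = ⟪e i, L b'⟫ := by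
    rw [← L.inner_map_map, L.apply_symm_apply]
  rw [affineRealization, affineRealization, hω i, h1, inner_add_right, add_assoc]
  rfl

theorem affineRealization_refl_ae [Countable I]
    (he : ∀ i, W (e i) =ᵐ[p] fun ω => ω i) :
    affineRealization W e (LinearIsometryEquiv.refl ℝ V) 0 =ᵐ[p] id := by
  filter_upwards [ae_all_iff.2 he] with ω hω
  funext i
  rw [affineRealization, inner_zero_right, add_zero]
  exact hω i

end IsIsonormal

/-! ### Continuity of Gaussian actions -/

/-- Factor `a² - b²` and apply Cauchy-Schwarz. The bound is uniform in `S`, so `L²` convergence of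
root densities gives convergence of measures in total variation. -/
theorem abs_setIntegral_sq_sub_le {X : Type*} [MeasurableSpace X] {p : Measure X} (a b : Lp ℝ 2 p)
    (S : Set X) :
    |∫ ω in S, a ω ^ 2 ∂p - ∫ ω in S, b ω ^ 2 ∂p| ≤ ‖a - b‖ * (‖a‖ + ‖b‖) := by
  have hi : ∀ c : Lp ℝ 2 p, Integrable (fun ω => c ω ^ 2) p := fun c => (Lp.memLp c).integrable_sq
  have hab : Integrable (fun ω => ‖(a - b : Lp ℝ 2 p) ω‖ * ‖(a + b : Lp ℝ 2 p) ω‖) p :=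
    (Lp.memLp (a - b)).norm.integrable_mul (Lp.memLp (a + b)).norm
  have h1 : (fun ω => a ω ^ 2 - b ω ^ 2) =ᵐ[p]
      fun ω => (a - b : Lp ℝ 2 p) ω * (a + b : Lp ℝ 2 p) ω := by
    filter_upwards [Lp.coeFn_sub a b, Lp.coeFn_add a b] with ω h2 h3
    rw [h2, h3, Pi.sub_apply, Pi.add_apply]
    ring
  have h2 : (fun ω => ‖(a - b : Lp ℝ 2 p) ω‖ * ‖(a + b : Lp ℝ 2 p) ω‖) =ᵐ[p]
      fun ω => ⟪(|a - b| : Lp ℝ 2 p) ω, (|a + b| : Lp ℝ 2 p) ω⟫ := by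
    filter_upwards [Lp.coeFn_abs (a - b), Lp.coeFn_abs (a + b)] with ω h2 h3
    rw [h2, h3, real_inner_eq_re_inner, RCLike.inner_apply', conj_trivial, RCLike.re_to_real]
    rfl
  rw [← integral_sub (hi a).integrableOn (hi b).integrableOn]
  calc |∫ ω in S, (a ω ^ 2 - b ω ^ 2) ∂p|
      = |∫ ω in S, (a - b : Lp ℝ 2 p) ω * (a + b : Lp ℝ 2 p) ω ∂p| := by
        rw [integral_congr_ae (ae_restrict_of_ae h1)]
    _ ≤ ∫ ω in S, ‖(a - b : Lp ℝ 2 p) ω‖ * ‖(a + b : Lp ℝ 2 p) ω‖ ∂p := by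
        rw [← Real.norm_eq_abs]
        refine norm_integral_le_of_norm_le hab.integrableOn (Eventually.of_forall fun ω => ?_)
        rw [norm_mul]
    _ ≤ ∫ ω, ‖(a - b : Lp ℝ 2 p) ω‖ * ‖(a + b : Lp ℝ 2 p) ω‖ ∂p :=
        setIntegral_le_integral hab (Eventually.of_forall fun ω => by positivity)
    _ = ⟪(|a - b| : Lp ℝ 2 p), (|a + b| : Lp ℝ 2 p)⟫ := by
        rw [integral_congr_ae h2, L2.inner_def]
    _ ≤ ‖(|a - b| : Lp ℝ 2 p)‖ * ‖(|a + b| : Lp ℝ 2 p)‖ := real_inner_le_norm _ _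
    _ ≤ ‖a - b‖ * (‖a‖ + ‖b‖) := by
        rw [norm_abs_eq_norm, norm_abs_eq_norm]
        gcongr
        exact norm_add_le _ _

theorem NonsingularAction.measureReal_map_eq {G X : Type*} [Group G] [TopologicalSpace G]
    [MeasurableSpace X] {p : Measure X} [IsProbabilityMeasure p] (A : NonsingularAction G X p)
    {D : X → ℝ≥0∞} (hD : Measurable D) {F : Lp ℝ 2 p}
    (hF : F =ᵐ[p] fun ω => Real.sqrt (D ω).toReal) [IsFiniteMeasure (p.withDensity D)] (g : G)
    {S : Set X} (hS : MeasurableSet S) :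
    ((p.withDensity D).map (A.act g)).real S = ∫ ω in S, A.koopman g F ω ^ 2 ∂p := by
  have : IsProbabilityMeasure (p.map (A.act g)) :=
    Measure.isProbabilityMeasure_map (A.quasi g).measurable.aemeasurable
  have hm' := (A.quasi g⁻¹).measurable
  have hmul : Measurable ((p.map (A.act g)).rnDeriv p * fun ω => D (A.act g⁻¹ ω)) :=
    (Measure.measurable_rnDeriv _ _).mul (hD.comp hm')
  have h1 := IsIsonormal.map_withDensity_comp A g hD
  rw [← Measure.withDensity_rnDeriv_eq (p.map (A.act g)) p (A.quasi g).absolutelyContinuous,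
    ← withDensity_mul _ (Measure.measurable_rnDeriv _ _) (g := fun ω => D (A.act g⁻¹ ω))
      (hD.comp hm')] at h1
  have h2 : A.koopman g F =ᵐ[p] A.koopmanFun g fun ω => Real.sqrt (D ω).toReal :=
    (A.memLp_koopmanFun g (Lp.memLp F)).coeFn_toLp.trans (A.koopmanFun_congr g hF)
  have h3 : (fun ω => A.koopman g F ω ^ 2) =ᵐ[p]
      fun ω => (((p.map (A.act g)).rnDeriv p * fun ω => D (A.act g⁻¹ ω)) ω).toReal := by
    filter_upwards [h2] with ω hω
    rw [hω, koopmanFun, mul_pow, Real.sq_sqrt ENNReal.toReal_nonneg,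
      Real.sq_sqrt ENNReal.toReal_nonneg, Pi.mul_apply, ENNReal.toReal_mul]
  have hfin : ∫⁻ ω, ((p.map (A.act g)).rnDeriv p * fun ω => D (A.act g⁻¹ ω)) ω ∂p ≠ ∞ := by
    rw [← setLIntegral_univ, ← withDensity_apply _ MeasurableSet.univ, h1]
    exact (measure_lt_top _ _).ne
  rw [integral_congr_ae (ae_restrict_of_ae h3), integral_toReal hmul.aemeasurable
    (ae_restrict_of_ae (ae_lt_top hmul hfin)), measureReal_def, ← h1, withDensity_apply _ hS]

/-- With the discrete topology on `G` the continuity axiom holds trivially, so Koopman operators are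
available before continuity for the original topology is known. -/
theorem exists_koopman_of_act {G X : Type*} [Group G] [MeasurableSpace X] {p : Measure X}
    [IsProbabilityMeasure p] (act : G → X → X)
    (quasi : ∀ g, Measure.QuasiMeasurePreserving (act g) p p)
    (one_ae : ∀ᵐ ω ∂p, act 1 ω = ω) (mul_ae : ∀ g h, ∀ᵐ ω ∂p, act (g * h) ω = act g (act h ω)) :
    ∃ U : G → Lp ℝ 2 p →L[ℝ] Lp ℝ 2 p,
      (∀ {V : Type*} [NormedAddCommGroup V] [InnerProductSpace ℝ V] {W : V → X → ℝ}
        (h : IsIsonormal W p) (g : G) (u v : V),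
        (shiftMeasure W p u).map (act g) = shiftMeasure W p v →
          U g (h.halfVec u) = h.halfVec v) ∧
      ∀ η : Measure X, IsProbabilityMeasure η → η ≪ p → ∃ F : Lp ℝ 2 p, ∀ g S, MeasurableSet S →
        (η.map (act g)).real S = ∫ ω in S, U g F ω ^ 2 ∂p := by
  let _ : TopologicalSpace G := ⊥
  have : DiscreteTopology G := ⟨rfl⟩
  let A : NonsingularAction G X p :=
    { act := act
      quasi := quasi
      one_ae := one_ae
      mul_ae := mul_ae
      continuous_at_one := fun η _ hη ε hε => by
        rw [nhds_discrete, eventually_pure]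
        intro S _
        rw [Measure.map_congr (g := id) (hη.ae_le one_ae), Measure.map_id, sub_self, abs_zero]
        exact hε.le }
  refine ⟨A.koopman, fun h g u v huv => h.koopman_halfVec A g huv, fun η _ hη => ?_⟩
  have hη' : p.withDensity (η.rnDeriv p) = η := Measure.withDensity_rnDeriv_eq η p hη
  have hm : Measurable fun ω => Real.sqrt (η.rnDeriv p ω).toReal :=
    (Measure.measurable_rnDeriv _ _).ennreal_toReal.sqrt
  have hF : MemLp (fun ω => Real.sqrt (η.rnDeriv p ω).toReal) 2 p := by
    rw [memLp_two_iff_integrable_sq hm.aestronglyMeasurable]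
    simp only [Real.sq_sqrt ENNReal.toReal_nonneg]
    exact Measure.integrable_toReal_rnDeriv
  have hfin : IsFiniteMeasure (p.withDensity (η.rnDeriv p)) := by rw [hη']; infer_instance
  refine ⟨hF.toLp _, fun g S hS => ?_⟩
  rw [← A.measureReal_map_eq (Measure.measurable_rnDeriv η p) hF.coeFn_toLp g hS, hη']

/-- A homomorphism into the automorphisms of a Gaussian density which covers a continuous affine
isometric action is continuous. -/
theorem IsGaussianDensity.exists_isGaussianAction {G V P X : Type*} [Group G] [TopologicalSpace G]
    [NormedAddCommGroup V] [InnerProductSpace ℝ V] [CompleteSpace V] [MetricSpace P]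
    [NormedAddTorsor V P] [MeasurableSpace X] {β : AffineIsometricAction G P} {m : P → Measure X}
    (hm : IsGaussianDensity m) (y : P) (act : G → X → X) (hact : ∀ g, Measurable (act g))
    (hmap : ∀ g x, (m x).map (act g) = m (β.hom g x))
    (one_ae : ∀ᵐ ω ∂(m y), act 1 ω = ω)
    (mul_ae : ∀ g h, ∀ᵐ ω ∂(m y), act (g * h) ω = act g (act h ω)) :
    ∃ A : NonsingularAction G X (m y), IsGaussianAction β m A := by
  have := hm.prob y
  have quasi : ∀ g, Measure.QuasiMeasurePreserving (act g) (m y) (m y) := fun g =>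
    ⟨hact g, by rw [hmap]; exact hm.equiv _ _⟩
  obtain ⟨U, hU, hUη⟩ := exists_koopman_of_act act quasi one_ae mul_ae
  obtain ⟨W, hW, hmW⟩ := hm.exists_isIsonormal y
  have hrep : IsOrthogonalRep U :=
    (hW.isGaussianKernel y).isOrthogonalRep (β := β) fun g a => hU hW g _ _ (by
      rw [← hmW, ← hmW]
      exact hmap g a)
  refine ⟨⟨act, quasi, one_ae, mul_ae, fun η hη hηm ε hε => ?_⟩, hmap⟩
  obtain ⟨F, hF⟩ := hUη η hη hηm
  have hone : η.map (act 1) = η := by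
    rw [Measure.map_congr (g := id) (hηm.ae_le one_ae), Measure.map_id]
  -- Continuity at `η` reduces to strong continuity of `U` at the root density `F`, which follows
  -- from the weak continuity supplied by `β` on the Gaussian kernel.
  have hlim : Tendsto (fun g => ‖U g F - F‖ * (‖F‖ + ‖F‖)) (𝓝 1) (𝓝 (0 * (‖F‖ + ‖F‖))) :=
    (hrep.tendsto_norm_sub F).mul_const _
  rw [zero_mul] at hlim
  filter_upwards [hlim.eventually (gt_mem_nhds hε)] with g hg S hS
  have h1 := hF 1 S hS
  rw [hone, hrep.one] at h1
  rw [hF g S hS, h1]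
  refine (abs_setIntegral_sq_sub_le _ _ S).trans ?_
  rw [hrep.norm_map]
  exact hg.le

/-! ### Existence of Gaussian densities and Gaussian actions -/

theorem IsIsonormal.isGaussianDensity {V P X : Type*} [NormedAddCommGroup V]
    [InnerProductSpace ℝ V] [CompleteSpace V] [MetricSpace P] [NormedAddTorsor V P]
    [MeasurableSpace X] {W : V → X → ℝ} {p : Measure X} (h : IsIsonormal W p) (o : P) :
    IsGaussianDensity fun x : P => shiftMeasure W p (x -ᵥ o) where
  prob x := h.isProbabilityMeasure_shiftMeasure _
  equiv x y := (shiftMeasure_absolutelyContinuous W p _).trans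
    (h.absolutelyContinuous_shiftMeasure _)
  exists_hat := by
    have hae : ∀ (x : P) {q : X → Prop}, (∀ᵐ ω ∂p, q ω) → ∀ᵐ ω ∂(shiftMeasure W p (x -ᵥ o)), q ω :=
      fun x _ hq => (shiftMeasure_absolutelyContinuous W p (x -ᵥ o)).ae_le hq
    -- An affine function is its value at `o` plus a linear functional of `x - o`, represented by a
    -- vector through Riesz.
    refine ⟨fun f ω => W ((InnerProductSpace.toDual ℝ V).symm f.contLinear) ω + f o,
      fun f => (h.measurable _).add_const _, fun f k x => hae x ?_, fun c f x => hae x ?_,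
      fun f x => ?_, fun S hS => ?_⟩
    · filter_upwards [h.add_ae ((InnerProductSpace.toDual ℝ V).symm f.contLinear)
        ((InnerProductSpace.toDual ℝ V).symm k.contLinear)] with ω hω
      rw [ContinuousAffineMap.add_contLinear, map_add, hω]
      simp only [Pi.add_apply, ContinuousAffineMap.add_apply]
      ring
    · filter_upwards [h.smul_ae c ((InnerProductSpace.toDual ℝ V).symm f.contLinear)] with ω hω
      rw [ContinuousAffineMap.smul_contLinear, LinearIsometryEquiv.map_smul, hω]
      simp [mul_add]
    · rw [h.map_add_const _ _ (h.map_shiftMeasure _ _), InnerProductSpace.toDual_symm_apply,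
        ContinuousAffineMap.contLinear_map_vsub, LinearIsometryEquiv.nnnorm_map]
      simp
    · obtain ⟨S', hS', hSS⟩ := h.generates S hS
      refine ⟨S', ?_, fun x => hae x hSS⟩
      have hle : (⨆ v, MeasurableSpace.comap (W v) inferInstance) ≤
          ⨆ f : P →ᴬ[ℝ] ℝ, MeasurableSpace.comap
            (fun ω => W ((InnerProductSpace.toDual ℝ V).symm f.contLinear) ω + f o)
            inferInstance := by
        refine iSup_le fun v => le_iSup_of_le (affineInner o v) ?_
        have e : (InnerProductSpace.toDual ℝ V).symm (affineInner o v).contLinear = v := by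
          rw [LinearIsometryEquiv.symm_apply_eq]
          rfl
        rw [e, affineInner_apply, vsub_self, inner_zero_right]
        simp
      exact hle _ hS'

/-- Every affine isometric action on a separable affine Hilbert space has a Gaussian action. -/
theorem AffineIsometricAction.exists_isGaussianAction {G V P : Type*} [Group G]
    [TopologicalSpace G] [NormedAddCommGroup V] [InnerProductSpace ℝ V] [CompleteSpace V]
    [TopologicalSpace.SeparableSpace V] [MetricSpace P] [NormedAddTorsor V P]
    (β : AffineIsometricAction G P) :
    ∃ (X : Type) (_ : MeasurableSpace X) (_ : StandardBorelSpace X) (m : P → Measure X),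
      IsGaussianDensity m ∧ ∀ y, ∃ A : NonsingularAction G X (m y), IsGaussianAction β m A := by
  obtain ⟨I, e, p, W, hW, hd, he⟩ := exists_isIsonormal V
  have o : P := (AddTorsor.nonempty (G := V) (P := P)).some
  have hm := hW.isGaussianDensity o
  refine ⟨I → ℝ, inferInstance, inferInstance, _, hm, fun y => ?_⟩
  have hac := shiftMeasure_absolutelyContinuous W p (y -ᵥ o)
  -- With origin `o`, `β g` is the affine map `v ↦ L v + b` that `affineRealization` lifts.
  have hlin : ∀ g (x : P), β.hom g x -ᵥ o
      = (β.hom g).linearIsometryEquiv (x -ᵥ o) + (β.hom g o -ᵥ o) := fun g x => by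
    rw [AffineIsometricAction.linear_apply _ _ o, vsub_vadd, vsub_add_vsub_cancel]
  refine hm.exists_isGaussianAction y
    (fun g => affineRealization W e (β.hom g).linearIsometryEquiv (β.hom g o -ᵥ o))
    (fun g => hW.measurable_affineRealization _ _) (fun g x => ?_) (hac.ae_le ?_)
    fun g h => hac.ae_le ?_
  · rw [hW.map_affineRealization_shiftMeasure he hd, ← hlin]
  · have h1 : (β.hom 1).linearIsometryEquiv = LinearIsometryEquiv.refl ℝ V := by
      rw [map_one]
      rfl
    rw [β.hom_one_apply, vsub_self, h1]
    exact IsIsonormal.affineRealization_refl_ae he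
  · have h1 : (β.hom (g * h)).linearIsometryEquiv
        = (β.hom h).linearIsometryEquiv.trans (β.hom g).linearIsometryEquiv := by
      rw [map_mul]
      rfl
    rw [h1, β.hom_mul_apply, hlin]
    exact hW.affineRealization_comp_ae he hd _ _ _ _

/-! ### The left regular representation -/

section LeftRegular

variable {G : Type*} [Group G] [TopologicalSpace G] [IsTopologicalGroup G]
  [LocallyCompactSpace G] [SecondCountableTopology G] [MeasurableSpace G] [BorelSpace G]

theorem leftRegular_apply (g : G) (ξ : Lp ℝ 2 (Measure.haar : Measure G)) :
    leftRegular G g ξ = DomMulAct.mk g⁻¹ • ξ := rfl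

theorem coeFn_leftRegular (g : G) (ξ : Lp ℝ 2 (Measure.haar : Measure G)) :
    leftRegular G g ξ =ᵐ[Measure.haar] fun h => ξ (g⁻¹ * h) :=
  Lp.coeFn_compMeasurePreserving ξ (measurePreserving_mul_left Measure.haar g⁻¹)

theorem inner_leftRegular_leftRegular (g : G) (ξ η : Lp ℝ 2 (Measure.haar : Measure G)) :
    ⟪leftRegular G g ξ, leftRegular G g η⟫ = ⟪ξ, η⟫ := by
  rw [L2.inner_def, L2.inner_def, ← integral_mul_left_eq_self (fun h => ⟪ξ h, η h⟫) g⁻¹]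
  refine integral_congr_ae ?_
  filter_upwards [coeFn_leftRegular g ξ, coeFn_leftRegular g η] with h hξ hη
  rw [hξ, hη]

theorem isOrthogonalRep_leftRegular : IsOrthogonalRep (leftRegular G) where
  one ξ := by simp [leftRegular_apply]
  mul g h ξ := by
    rw [leftRegular_apply, leftRegular_apply, leftRegular_apply, mul_inv_rev, DomMulAct.mk_mul,
      mul_smul]
  adjoint g ξ η := by
    have h1 : leftRegular G g⁻¹ (leftRegular G g ξ) = ξ := by
      rw [leftRegular_apply, leftRegular_apply, ← mul_smul, ← DomMulAct.mk_mul]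
      simp
    conv_rhs => rw [← h1]
    exact (inner_leftRegular_leftRegular g⁻¹ _ _).symm
  continuous ξ η := by
    have : Fact ((2 : ℝ≥0∞) ≠ ∞) := ⟨by norm_num⟩
    have : Continuous fun g : G => DomMulAct.mk g⁻¹ • ξ :=
      (DomMulAct.continuous_mk.comp continuous_inv).smul continuous_const
    exact this.inner continuous_const

theorem dense_hasCompactSupport : Dense {F : Lp ℝ 2 (Measure.haar : Measure G) |
    ∃ f : G → ℝ, HasCompactSupport f ∧ F =ᵐ[Measure.haar] f} := by
  refine Metric.dense_iff.2 fun F ε hε => ?_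
  obtain ⟨f, hf, hFf, -, hfm⟩ := (Lp.memLp F).exists_hasCompactSupport_eLpNorm_sub_le
    (by norm_num) (ε := ENNReal.ofReal (ε / 2)) (by simpa using hε)
  refine ⟨hfm.toLp f, ?_, f, hf, hfm.coeFn_toLp⟩
  rw [Metric.mem_ball, dist_comm, Lp.dist_def, eLpNorm_congr_ae
    ((EventuallyEq.refl _ (F : G → ℝ)).sub hfm.coeFn_toLp)]
  have := ENNReal.toReal_mono ENNReal.ofReal_ne_top hFf
  rw [ENNReal.toReal_ofReal (by positivity)] at this
  linarith

/-- With `K` the support of `f`, the coefficient vanishes for `g` outside the compact set `K K⁻¹`,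
on which `φ` is bounded away from zero. -/
theorem exists_inner_leftRegular_le {F : Lp ℝ 2 (Measure.haar : Measure G)} {f : G → ℝ}
    (hf : HasCompactSupport f) (hF : F =ᵐ[Measure.haar] f) {φ : G → ℝ} (hφ : Continuous φ)
    (hφ0 : ∀ g, 0 < φ g) : ∃ C, 0 < C ∧ ∀ g, ⟪leftRegular G g F, F⟫ ≤ C * φ g := by
  have hK : IsCompact (tsupport f) := hf
  have hQ : IsCompact ((fun x : G × G => x.1 * x.2⁻¹) '' (tsupport f ×ˢ tsupport f)) :=
    (hK.prod hK).image (by fun_prop)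
  obtain ⟨M, hM⟩ := hQ.exists_bound_of_continuousOn (f := fun g => (φ g)⁻¹)
    (hφ.inv₀ fun g => (hφ0 g).ne').continuousOn
  refine ⟨‖F‖ * ‖F‖ * |M| + 1, by positivity, fun g => ?_⟩
  have hCφ : 0 ≤ (‖F‖ * ‖F‖ * |M| + 1) * φ g := mul_nonneg (by positivity) (hφ0 g).le
  by_cases hg : g ∈ (fun x : G × G => x.1 * x.2⁻¹) '' (tsupport f ×ˢ tsupport f)
  · have h1 : 1 ≤ |M| * φ g := by
      have h2 := (hM g hg).trans (le_abs_self M)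
      rw [Real.norm_of_nonneg (inv_nonneg.2 (hφ0 g).le)] at h2
      calc 1 = (φ g)⁻¹ * φ g := (inv_mul_cancel₀ (hφ0 g).ne').symm
        _ ≤ |M| * φ g := mul_le_mul_of_nonneg_right h2 (hφ0 g).le
    have h3 := (le_abs_self _).trans (isOrthogonalRep_leftRegular.abs_inner_le g F F)
    nlinarith [mul_le_mul_of_nonneg_left h1 (mul_self_nonneg ‖F‖), hφ0 g]
  · suffices h : ⟪leftRegular G g F, F⟫ = 0 by rwa [h]
    rw [L2.inner_def]
    refine integral_eq_zero_of_ae ?_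
    have hq := (measurePreserving_mul_left (Measure.haar : Measure G) g⁻¹).quasiMeasurePreserving
    filter_upwards [coeFn_leftRegular g F, hF, hq.ae hF] with h h1 h2 h3
    rw [h1, h2, h3, real_inner_eq_re_inner, RCLike.inner_apply', conj_trivial, RCLike.re_to_real]
    by_contra hne
    refine hg ⟨(h, g⁻¹ * h), ⟨subset_tsupport f (right_ne_zero_of_mul hne),
      subset_tsupport f (left_ne_zero_of_mul hne)⟩, ?_⟩
    simp

theorem le_of_forall_mul_pow_le {c r R : ℝ} (hc : 0 < c) (hR : 0 ≤ R)
    (h : ∀ n : ℕ, c * r ^ (2 * n) ≤ R ^ (2 * n)) : r ≤ R := by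
  by_contra! hlt
  have hr : 0 < r := hR.trans_lt hlt
  have h1 : R / r < 1 := (div_lt_one hr).2 hlt
  obtain ⟨n, hn⟩ := exists_pow_lt_of_lt_one hc h1
  have h2 : (R / r) ^ (2 * n) ≤ (R / r) ^ n :=
    pow_le_pow_of_le_one (by positivity) h1.le (by omega)
  have h3 : c ≤ (R / r) ^ (2 * n) := by
    rw [div_pow, le_div_iff₀ (by positivity)]
    exact h n
  linarith

/-- Compact support makes any positive continuous function dominate the coefficients, so neither
subadditivity of `ℓ` nor a loss `c < 1` is involved. -/
theorem exists_hasSpectralRadius_leftRegular (μ : Measure G) [IsProbabilityMeasure μ]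
    (hμ : μ.map (fun g => g⁻¹) = μ) :
    ∃ ρ, HasSpectralRadius (leftRegular G) μ ρ ∧ ∀ (ℓ : G → ℝ) (s R : ℝ), Continuous ℓ → 0 ≤ s →
      0 ≤ R → (∀ n, walkLaplace μ ℓ n s ≤ R ^ n) → ρ ≤ R := by
  have hrep := isOrthogonalRep_leftRegular (G := G)
  obtain ⟨T, hT, -⟩ := hrep.exists_isWeakIntegral μ
  refine ⟨‖T‖, ⟨T, hT, rfl⟩, fun ℓ s R hℓ hs hR hle => ?_⟩
  refine le_of_forall_lt fun r hr => ?_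
  by_contra! hRr
  obtain ⟨r', hrr', hr'⟩ := exists_between hr
  have hr0 : 0 ≤ r' := hR.trans (hRr.trans hrr'.le)
  obtain ⟨c, hc, hcn⟩ := hrep.exists_pow_le_integral hT hμ dense_hasCompactSupport
    (φ := fun g => Real.exp (-s * ℓ g ^ 2))
    (fun n => integrable_exp_neg_mul_sq_comp hℓ.measurable _ hs)
    (fun F ⟨f, hf, hF⟩ => exists_inner_leftRegular_le hf hF (by fun_prop) fun g => Real.exp_pos _)
    hr0 hr'
  have := le_of_forall_mul_pow_le hc hR fun n =>
    (hcn n).trans ((walkLaplace_eq hℓ.measurable _ _).ge.trans (hle _))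
  linarith

end LeftRegular

/-! ### Cocycles of inflated actions -/

namespace AffineIsometricAction

variable {G V P : Type*} [Group G] [TopologicalSpace G] [NormedAddCommGroup V]
  [InnerProductSpace ℝ V] [MetricSpace P] [NormedAddTorsor V P] (α : AffineIsometricAction G P)

theorem norm_cocycle_inflate (t : {t : ℝ // 0 < t}) (x : P) (g : G) :
    ‖(α.inflate t).cocycle ⟨x⟩ g‖ = t * ‖α.cocycle x g‖ := by
  rw [norm_cocycle, norm_cocycle]
  rfl

theorem walkLaplace_inflate [MeasurableSpace G] (μ : Measure G) (t : {t : ℝ // 0 < t}) (x : P)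
    (n : ℕ) : walkLaplace μ (fun g => ‖(α.inflate t).cocycle ⟨x⟩ g‖) n (1 / 8)
      = walkLaplace μ (fun g => ‖α.cocycle x g‖) n ((t : ℝ) ^ 2 / 8) := by
  unfold walkLaplace
  simp only [norm_cocycle_inflate]
  congr 2 with g
  ring_nf

theorem norm_cocycle_linearPart (g : G) : ‖α.linearPart.cocycle 0 g‖ = 0 := by
  rw [norm_eq_zero, cocycle, vsub_eq_sub, sub_zero]
  exact (α.hom g).linearIsometryEquiv.map_zero

/-- The `μ`-harmonic seminorm bounds the Laplace transform of the first step from below. -/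
theorem exp_neg_le_walkLaplace_one [MeasurableSpace G] [OpensMeasurableSpace G] [MeasurableMul₂ G]
    (μ : Measure G) [IsProbabilityMeasure μ] (x : P) {s : ℝ} (hs : 0 ≤ s)
    (hfin : ∫⁻ g, ENNReal.ofReal (‖α.cocycle x g‖ ^ 2) ∂μ ≠ ∞) :
    Real.exp (-s * (∫⁻ g, ENNReal.ofReal (‖α.cocycle x g‖ ^ 2) ∂μ).toReal)
      ≤ walkLaplace μ (fun g => ‖α.cocycle x g‖) 1 s := by
  have hm := α.measurable_norm_cocycle x
  rw [walkLaplace_eq hm, walkLaw_one]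
  have hi : Integrable (fun g => ‖α.cocycle x g‖ ^ 2) μ := by
    refine ⟨(hm.pow_const 2).aestronglyMeasurable, ?_⟩
    rw [hasFiniteIntegral_iff_ofReal (Eventually.of_forall fun g => sq_nonneg _)]
    exact hfin.lt_top
  rw [← integral_eq_lintegral_of_nonneg_ae (Eventually.of_forall fun g => sq_nonneg _)
    hi.aestronglyMeasurable, ← integral_const_mul]
  -- Jensen's inequality for the exponential.
  exact convexOn_exp.map_integral_le Real.continuous_exp.continuousOn isClosed_univ
    (Eventually.of_forall fun g => Set.mem_univ _) (hi.const_mul _)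
    (integrable_exp_neg_mul_sq_comp hm μ hs)

/-- One `R` serves all base points, so `-log R / s` is a lower bound for every energy and hence for
their infimum; infinite energies satisfy it trivially. -/
theorem exp_neg_harmonicSq_le [MeasurableSpace G] [OpensMeasurableSpace G] [MeasurableMul₂ G]
    (μ : Measure G) [IsProbabilityMeasure μ] {s R : ℝ} (hs : 0 ≤ s) (hR : 0 < R)
    (h : α.harmonicSq μ ≠ ∞)
    (hle : ∀ x, walkLaplace μ (fun g => ‖α.cocycle x g‖) 1 s ≤ R) :
    Real.exp (-s * (α.harmonicSq μ).toReal) ≤ R := by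
  rcases hs.eq_or_lt with rfl | hs'
  · have x : P := (AddTorsor.nonempty (G := V) (P := P)).some
    have := hle x
    rw [walkLaplace_zero (α.measurable_norm_cocycle x)] at this
    simpa using this
  have key : ENNReal.ofReal (-Real.log R / s) ≤ α.harmonicSq μ := by
    refine le_iInf fun x => ?_
    by_cases hfin : ∫⁻ g, ENNReal.ofReal (‖α.cocycle x g‖ ^ 2) ∂μ = ∞
    · rw [hfin]
      exact le_top
    · rw [ENNReal.ofReal_le_iff_le_toReal hfin, div_le_iff₀ hs']
      have h1 := (α.exp_neg_le_walkLaplace_one μ x hs hfin).trans (hle x)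
      rw [← Real.le_log_iff_exp_le hR] at h1
      linarith
  rw [ENNReal.ofReal_le_iff_le_toReal h, div_le_iff₀ hs'] at key
  rw [← Real.le_log_iff_exp_le hR]
  linarith

end AffineIsometricAction

/-! ### Limits of Laplace transforms -/

section Limit

variable {G : Type*} [Group G] [MeasurableSpace G] [MeasurableMul₂ G] {μ : Measure G}
  [IsProbabilityMeasure μ] {ℓ : G → ℝ} {f : ℝ → ℝ}

theorem antitoneOn_of_tendsto_walkLaplace (hℓ : Measurable ℓ)
    (hf : ∀ s, 0 ≤ s → Tendsto (fun n : ℕ => walkLaplace μ ℓ n s ^ (1 / (n : ℝ))) atTop (𝓝 (f s))) :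
    AntitoneOn f (Set.Ici 0) := fun s hs t ht hst => by
  refine le_of_tendsto_of_tendsto' (hf t ht) (hf s hs) fun n => ?_
  have := (walkLaplace_pos (μ := μ) hℓ n (s := t) ht).le
  gcongr
  exact walkLaplace_anti hℓ n hs hst

theorem convexOn_log_of_tendsto_walkLaplace (hℓ : Measurable ℓ)
    (hf : ∀ s, 0 ≤ s → Tendsto (fun n : ℕ => walkLaplace μ ℓ n s ^ (1 / (n : ℝ))) atTop (𝓝 (f s)))
    (hpos : ∀ s, 0 ≤ s → 0 < f s) : ConvexOn ℝ (Set.Ici 0) fun s => Real.log (f s) := by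
  have hlog : ∀ s, 0 ≤ s → Tendsto (fun n : ℕ => 1 / (n : ℝ) * Real.log (walkLaplace μ ℓ n s)) atTop
      (𝓝 (Real.log (f s))) := fun s hs => by
    refine ((hf s hs).log (hpos s hs).ne').congr fun n => ?_
    rw [Real.log_rpow (walkLaplace_pos hℓ n hs)]
  refine ⟨convex_Ici 0, fun s hs t ht a b ha hb hab => ?_⟩
  have hst : 0 ≤ a • s + b • t := convex_Ici 0 hs ht ha hb hab
  refine le_of_tendsto_of_tendsto' (hlog _ hst)
    (((hlog s hs).const_smul a).add ((hlog t ht).const_smul b)) fun n => ?_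
  have h1 := (convexOn_log_walkLaplace (μ := μ) hℓ n).2 hs ht ha hb hab
  have h2 := mul_le_mul_of_nonneg_left h1 (by positivity : 0 ≤ 1 / (n : ℝ))
  simp only [smul_eq_mul] at h2 ⊢
  linarith

/-- Convexity of `log f` gives continuity only on the open half-line. At `0`, `f` is squeezed
between the single-step Laplace transform, continuous by dominated convergence, and `1`. -/
theorem continuousOn_of_tendsto_walkLaplace (hℓ : Measurable ℓ)
    (hf : ∀ s, 0 ≤ s → Tendsto (fun n : ℕ => walkLaplace μ ℓ n s ^ (1 / (n : ℝ))) atTop (𝓝 (f s)))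
    (hpos : ∀ s, 0 ≤ s → 0 < f s) (hf1 : ∀ s, 0 ≤ s → f s ≤ 1)
    (hle : ∀ s, 0 ≤ s → walkLaplace μ ℓ 1 s ≤ f s) : ContinuousOn f (Set.Ici 0) := by
  intro s hs
  rcases (show (0 : ℝ) ≤ s from hs).eq_or_lt with rfl | hs'
  · have h0 : f 0 = 1 := le_antisymm (hf1 0 le_rfl) (by
      rw [← walkLaplace_zero (μ := μ) hℓ 1]
      exact hle 0 le_rfl)
    have h1 : Tendsto (fun s => ∫ g, Real.exp (-s * ℓ g ^ 2) ∂(walkLaw μ 1)) (𝓝[Set.Ici 0] 0)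
        (𝓝 (∫ g, Real.exp (-0 * ℓ g ^ 2) ∂(walkLaw μ 1))) := by
      refine tendsto_integral_filter_of_dominated_convergence (fun _ => 1)
        (Eventually.of_forall fun s => by fun_prop) ?_ (integrable_const 1)
        (Eventually.of_forall fun g => ?_)
      · filter_upwards [self_mem_nhdsWithin] with s hs
        refine Eventually.of_forall fun g => ?_
        rw [Real.norm_of_nonneg (Real.exp_pos _).le]
        exact exp_neg_mul_sq_le_one hs _
      · refine Tendsto.mono_left ?_ nhdsWithin_le_nhds
        exact Continuous.tendsto (f := fun s => Real.exp (-s * ℓ g ^ 2)) (by fun_prop) 0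
    simp only [← walkLaplace_eq hℓ] at h1
    rw [walkLaplace_zero hℓ] at h1
    rw [ContinuousWithinAt, h0]
    refine tendsto_of_tendsto_of_tendsto_of_le_of_le' h1 tendsto_const_nhds ?_ ?_
    · filter_upwards [self_mem_nhdsWithin] with s hs using hle s hs
    · filter_upwards [self_mem_nhdsWithin] with s hs using hf1 s hs
  · have h1 := (convexOn_log_of_tendsto_walkLaplace hℓ hf hpos).continuousOn_interior
    rw [interior_Ici] at h1
    have h2 : ContinuousAt (fun s => Real.exp (Real.log (f s))) s :=
      (h1.continuousAt (Ioi_mem_nhds hs')).rexp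
    refine (h2.congr ?_).continuousWithinAt
    filter_upwards [Ioi_mem_nhds hs'] with t ht
    exact Real.exp_log (hpos t (le_of_lt ht))

end Limit

/-! ### Assembly of the theorem. -/

theorem hasGaussianSpectralRadius_of_tendsto {G V P : Type*} [Group G] [TopologicalSpace G]
    [IsTopologicalGroup G] [SecondCountableTopology G] [MeasurableSpace G] [BorelSpace G]
    [NormedAddCommGroup V] [InnerProductSpace ℝ V] [CompleteSpace V]
    [TopologicalSpace.SeparableSpace V] [MetricSpace P] [NormedAddTorsor V P]
    (β : AffineIsometricAction G P) (μ : Measure G) [IsProbabilityMeasure μ]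
    (hμ : μ.map (fun g => g⁻¹) = μ) (x : P) {R : ℝ}
    (hR : Tendsto (fun n : ℕ => walkLaplace μ (fun g => ‖β.cocycle x g‖) n (1 / 8) ^ (1 / (n : ℝ)))
      atTop (𝓝 R)) : HasGaussianSpectralRadius.{w} β μ R := by
  refine ⟨β.exists_isGaussianAction, fun X _ _ m _ hm y A hA => ?_⟩
  -- The limit involves only `β`, so its uniqueness forces the same radius in every realization.
  obtain ⟨r, hr, -, hx⟩ := hA.exists_hasSpectralRadius hm μ hμ
  rwa [tendsto_nhds_unique hR (hx x).2]

/-- The limit exists because it is the norm of an averaged operator for the Gaussian action of an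
inflation. That operator does not involve `x`, whence a single `R` for all base points. -/
theorem exists_tendsto_walkLaplace {G V P : Type*} [Group G] [TopologicalSpace G]
    [IsTopologicalGroup G] [SecondCountableTopology G] [MeasurableSpace G] [BorelSpace G]
    [NormedAddCommGroup V] [InnerProductSpace ℝ V] [CompleteSpace V]
    [TopologicalSpace.SeparableSpace V] [MetricSpace P] [NormedAddTorsor V P]
    (α : AffineIsometricAction G P) (μ : Measure G) [IsProbabilityMeasure μ]
    (hμ : μ.map (fun g => g⁻¹) = μ) {s : ℝ} (hs : 0 ≤ s) :
    ∃ R, R ≤ 1 ∧ ∀ x, (∀ n, walkLaplace μ (fun g => ‖α.cocycle x g‖) n s ≤ R ^ n) ∧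
      Tendsto (fun n : ℕ => walkLaplace μ (fun g => ‖α.cocycle x g‖) n s ^ (1 / (n : ℝ)))
        atTop (𝓝 R) := by
  rcases hs.eq_or_lt with rfl | hs'
  · refine ⟨1, le_rfl, fun x => ?_⟩
    simp [walkLaplace_zero (α.measurable_norm_cocycle x)]
  -- Chosen so that `t² / 8 = s`; this needs `s > 0`.
  let t : {t : ℝ // 0 < t} := ⟨Real.sqrt (8 * s), Real.sqrt_pos.2 (by positivity)⟩
  have ht : (t : ℝ) ^ 2 / 8 = s := by
    rw [Real.sq_sqrt (by positivity)]
    ring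
  obtain ⟨X, _, _, m, hm, hA⟩ := (α.inflate t).exists_isGaussianAction
  have y : Inflation t P := (AddTorsor.nonempty (G := V) (P := Inflation t P)).some
  obtain ⟨A, hA⟩ := hA y
  have := hm.prob y
  obtain ⟨r, -, hr1, hx⟩ := hA.exists_hasSpectralRadius hm μ hμ
  refine ⟨r, hr1, fun x => ?_⟩
  have := hx ⟨x⟩
  simpa only [α.walkLaplace_inflate, ht] using this

theorem mainTheorem8 {G V P : Type*}
    [Group G] [TopologicalSpace G] [IsTopologicalGroup G] [T2Space G] [LocallyCompactSpace G]
    [SecondCountableTopology G] [MeasurableSpace G] [BorelSpace G]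
    [NormedAddCommGroup V] [InnerProductSpace ℝ V] [CompleteSpace V]
    [TopologicalSpace.SeparableSpace V] [MetricSpace P] [NormedAddTorsor V P]
    (α : AffineIsometricAction G P) (x : P)
    (μ : Measure G) [IsProbabilityMeasure μ] (hμ : μ.map (fun g => g⁻¹) = μ) :
    ∃ f : ℝ → ℝ,
      (∀ s, 0 ≤ s →
        Tendsto
          (fun n : ℕ =>
            walkExpectation μ n (fun g => Real.exp (-s * ‖α.cocycle x g‖ ^ 2)) ^ (1 / (n : ℝ)))
          atTop (𝓝 (f s))) ∧
      (∀ s, 0 ≤ s → 0 < f s ∧ f s ≤ 1) ∧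
      (HasGaussianSpectralRadius.{w} α.linearPart μ (f 0) ∧
        ∀ t : {t : ℝ // 0 < t},
          HasGaussianSpectralRadius.{w} (α.inflate t) μ (f ((t : ℝ) ^ 2 / 8))) ∧
      (∃ ρ : ℝ, HasSpectralRadius (leftRegular G) μ ρ ∧ ∀ s, 0 ≤ s → ρ ≤ f s) ∧
      (α.harmonicSq μ ≠ ∞ →
        ∀ s, 0 ≤ s → Real.exp (-s * (α.harmonicSq μ).toReal) ≤ f s) ∧
      ContinuousOn f (Set.Ici 0) ∧
      AntitoneOn f (Set.Ici 0) ∧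
      ConvexOn ℝ (Set.Ici 0) (fun s => Real.log (f s)) := by
  have hex : ∀ s : ℝ, ∃ R, 0 ≤ s → R ≤ 1 ∧ ∀ x,
      (∀ n, walkLaplace μ (fun g => ‖α.cocycle x g‖) n s ≤ R ^ n) ∧
      Tendsto (fun n : ℕ => walkLaplace μ (fun g => ‖α.cocycle x g‖) n s ^ (1 / (n : ℝ)))
        atTop (𝓝 R) := fun s => by
    by_cases hs : 0 ≤ s
    · obtain ⟨R, hR⟩ := exists_tendsto_walkLaplace α μ hμ hs
      exact ⟨R, fun _ => hR⟩
    -- The value at negative `s` is arbitrary, since the conclusions concern `s ≥ 0` only.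
    · exact ⟨0, fun h => absurd h hs⟩
  choose f hf using hex
  have hℓ := α.measurable_norm_cocycle x
  have hlim := fun s hs => ((hf s hs).2 x).2
  have hle1 : ∀ s, 0 ≤ s → ∀ x, walkLaplace μ (fun g => ‖α.cocycle x g‖) 1 s ≤ f s :=
    fun s hs x => by simpa using ((hf s hs).2 x).1 1
  have hpos : ∀ s, 0 ≤ s → 0 < f s := fun s hs => (walkLaplace_pos hℓ 1 hs).trans_le (hle1 s hs x)
  have hf1 : ∀ s, 0 ≤ s → f s ≤ 1 := fun s hs => (hf s hs).1
  have hf0 : f 0 = 1 := le_antisymm (hf1 0 le_rfl) (by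
    rw [← walkLaplace_zero (μ := μ) hℓ 1]
    exact hle1 0 le_rfl x)
  refine ⟨f, hlim, fun s hs => ⟨hpos s hs, hf1 s hs⟩, ⟨?_, fun t => ?_⟩, ?_,
    fun h s hs => α.exp_neg_harmonicSq_le μ hs (hpos s hs) h (hle1 s hs),
    continuousOn_of_tendsto_walkLaplace hℓ hlim hpos hf1 fun s hs => hle1 s hs x,
    antitoneOn_of_tendsto_walkLaplace hℓ hlim, convexOn_log_of_tendsto_walkLaplace hℓ hlim hpos⟩
  -- At the fixed point `0` of the linear part the cocycle vanishes, so the Laplace transform is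
  -- constantly `1 = f 0`.
  · refine hasGaussianSpectralRadius_of_tendsto α.linearPart μ hμ 0 ?_
    simp [walkLaplace, walkExpectation, α.norm_cocycle_linearPart, hf0]
  · refine hasGaussianSpectralRadius_of_tendsto (α.inflate t) μ hμ ⟨x⟩ ?_
    simp only [α.walkLaplace_inflate]
    exact hlim _ (by positivity)
  · obtain ⟨ρ, hρ, hρR⟩ := exists_hasSpectralRadius_leftRegular μ hμ
    exact ⟨ρ, hρ, fun s hs => hρR _ s _ (α.continuous_norm_cocycle x) hs (hpos s hs).le
      ((hf s hs).2 x).1⟩
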